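/- Fix a signature $\mathcal F$, an infinite set $\mathcal V$ of variables, and a set $\mathcal B$ of equations with $\mathrm{Var}(\ell)=\mathrm{Var}(r)$ for all $\ell\approx r\in\mathcal B$. For a set $\mathcal E$ of pairs of terms, $\to_{\mathcal E}$ is its closure under contexts and substitutions, $\leftrightarrow_{\mathcal E}$ the symmetric closure of $\to_{\mathcal E}$, and $\mathcal E^{\pm}=\mathcal E\cup\{t\approx s\mid s\approx t\in\mathcal E\}$. Let ${\sim}={\leftrightarrow_{\mathcal B}^*}$, ${\to_{\mathcal R/\mathcal B}}={\sim\cdot\to_{\mathcal R}\cdot\sim}$ and ${\downarrow^{\sim}_{\mathcal R}}={\to_{\mathcal R}^*\cdot\sim\cdot{}_{\mathcal R}^{*}{\leftarrow}}$. A TRS is a set of rules $\ell\to r$ with $\ell\notin\mathcal V$ and $\mathrm{Var}(r)\subseteq\mathrm{Var}(\ell)$. Let $>$ be a $\mathcal B$-compatible reduction order, i.e. a well-founded strict order on terms that is closed under contexts and substitutions and satisfies ${\sim\cdot>\cdot\sim}\subseteq{>}$. The inference system $I_{\mathcal B}$ transforms pairs $(\mathcal E,\mathcal R)$ by the following rules,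 where $\uplus$ is disjoint union and $s\mathrel{\dot\approx}t$ stands for $s\approx t$ or $t\approx s$: - deduce: $(\mathcal E,\mathcal R)\Rightarrow(\mathcal E\cup\{s\approx t\},\mathcal R)$ if $s\mathrel{{}_{\mathcal R}{\leftarrow}}\cdot\to_{\mathcal R\cup\mathcal B^{\pm}}t$; - orient: $(\mathcal E\uplus\{s\mathrel{\dot\approx}t\},\mathcal R)\Rightarrow(\mathcal E,\mathcal R\cup\{s\to t\})$ if $s>t$; - delete: $(\mathcal E\uplus\{s\approx t\},\mathcal R)\Rightarrow(\mathcal E,\mathcal R)$ if $s\sim t$; - simplify: $(\mathcal E\uplus\{s\mathrel{\dot\approx}t\},\mathcal R)\Rightarrow(\mathcal E\cup\{u\approx t\},\mathcal R)$ if $s\to_{\mathcal R}u$; - collapse: $(\mathcal E,\mathcal R\uplus\{s\to t\})\Rightarrow(\mathcal E\cup\{u\approx t\},\mathcal R)$ if $s\to_{\mathcal R}u$; - compose: $(\mathcal E,\mathcal R\uplus\{s\to t\})\Rightarrow(\mathcal E,\mathcal R\cup\{s\to u\})$ if $t\to_{\mathcal R}u$. An overlap of $\mathcal R_1$ and $\mathcal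 R_2$ is a triple $\langle\ell_1\to r_1,p,\ell_2\to r_2\rangle$ where the $\ell_i\to r_i$ are variants (under renamings of variables) of elements of $\mathcal R_i$ without common variables, $p$ is a function-symbol position of $\ell_2$, $\ell_1$ and $\ell_2|_p$ are unifiable, and the two rules are not variants of each other if $p=\epsilon$. For a most general unifier $\sigma$ of $\ell_1$ and $\ell_2|_p$ it gives the critical pair $\ell_2\sigma[r_1\sigma]_p\approx r_2\sigma$ with source $\ell_2\sigma$; the critical pair is prime (with respect to a TRS $\mathcal R$) if all proper subterms of $\ell_2\sigma|_p$ are $\to_{\mathcal R}$-normal forms. $\mathrm{PCP}(\mathcal R)$ is the set of prime critical pairs obtained from overlaps of $\mathcal R$ and $\mathcal R$, and $\mathrm{PCP}^{\pm}(\mathcal R,\mathcal B^{\pm})$ is the set of those obtained from overlaps of $\mathcal R$ and $\mathcal B^{\pm}$ or of $\mathcal B^{\pm}$ and $\mathcal R$, primality being with respect to $\mathcal R$ in all cases. A run $(\mathcal E_0,\mathcal R_0)\Rightarrow\cdots\Rightarrow(\mathcal E_n,\mathcal R_n)$ in $I_{\mathcal B}$ with $\mathcal R_0=\varnothing$ is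 fair if $\mathcal R_n$ is left-linear and $$\mathrm{PCP}(\mathcal R_n)\cup\mathrm{PCP}^{\pm}(\mathcal R_n,\mathcal B^{\pm})\subseteq{\downarrow^{\sim}_{\mathcal R_n}}\cup\bigcup_{i=0}^{n}{\leftrightarrow_{\mathcal E_i}}.$$ **Lemma.** If $(\mathcal E,\varnothing)\Rightarrow^*(\varnothing,\mathcal R)$ is a fair run in $I_{\mathcal B}$ and neither compose nor collapse is applicable to $(\varnothing,\mathcal R)$, then $\mathcal R$ is a TRS that is canonical modulo $\mathcal B$, that is: 1. there is no infinite sequence of $\to_{\mathcal R/\mathcal B}$-steps; 2. $\mathcal R$ is Church–Rosser modulo $\mathcal B$: $({{}_{\mathcal R}{\leftarrow}}\cup{\to_{\mathcal R}}\cup{\sim})^*\subseteq{\downarrow^{\sim}_{\mathcal R}}$; 3. for every $\ell\to r\in\mathcal R$, $\ell$ is a normal form of $\mathcal R\setminus\{\ell\to r\}$; 4. for every $\ell\to r\in\mathcal R$, $r$ is a normal form of $\to_{\mathcal R/\mathcal B}$. -/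

import Mathlib

universe u v w

namespace CompletionModulo

section Terms

variable {L : FirstOrder.Language.{u, v}} {V : Type w}

/-- The subterm `t|_p` of `t` at position `p`, if `p` is a position of `t`.  Positions are finite
sequences of argument indices (counted from `0`), the empty sequence being the root position. -/
def subtermAt : L.Term V → List ℕ → Option (L.Term V)
  | t, [] => some t
  | .var _, _ :: _ => none
  | @FirstOrder.Language.Term.func _ _ n _ ts, i :: p => if h : i < n then subtermAt (ts ⟨i, h⟩) p else none

/-- The term `t[u]_p`: the subterm of `t` at position `p` is replaced by `u`
(the value is `t` when `p` is not a position of `t`). -/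
def replaceAt : L.Term V → List ℕ → L.Term V → L.Term V
  | _, [], u => u
  | .var x, _ :: _, _ => .var x
  | .func f ts, i :: p, u =>
      .func f (fun j => if (j : ℕ) = i then replaceAt (ts j) p u else ts j)

/-- The set `Pos(t)` of positions of `t`. -/
def positions (t : L.Term V) : Set (List ℕ) := {p | ∃ u, subtermAt t p = some u}

/-- The term `t` is a variable. -/
def IsVar (t : L.Term V) : Prop := ∃ x, t = .var x

/-- The set `Pos_F(t)` of positions of `t` that address function symbols. -/
def funPositions (t : L.Term V) : Set (List ℕ) := {p | ∃ u, subtermAt t p = some u ∧ ¬ IsVar u}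

open Classical in
/-- The set `Var(t)` of variables of `t`. -/
noncomputable def vars (t : L.Term V) : Set V := ↑t.varFinset

/-- A term is linear if no variable occurs in it at two different positions. -/
def IsLinear (t : L.Term V) : Prop :=
  ∀ p q x, subtermAt t p = some (.var x) → subtermAt t q = some (.var x) → p = q

/-- Substitutions are the maps from variables to terms with finite domain. -/
def IsSubst (σ : V → L.Term V) : Prop := {x | σ x ≠ .var x}.Finite

/-- Renamings are the bijective substitutions from variables to variables. -/
def IsRenaming (π : Equiv.Perm V) : Prop := {x | π x ≠ x}.Finite

/-- `σ` is a unifier of `s` and `t`. -/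
def IsUnifier (σ : V → L.Term V) (s t : L.Term V) : Prop :=
  IsSubst σ ∧ s.subst σ = t.subst σ

/-- `σ` is a most general unifier of `s` and `t`: every unifier is of the form `σρ`. -/
def IsMGU (σ : V → L.Term V) (s t : L.Term V) : Prop :=
  IsUnifier σ s t ∧
    ∀ τ, IsUnifier τ s t → ∃ ρ : V → L.Term V, IsSubst ρ ∧ ∀ x, (σ x).subst ρ = τ x

end Terms

section Systems

variable {L : FirstOrder.Language.{u, v}} {V : Type w}

/-- A set of pairs of terms; its elements are read as equations or as rewrite rules. -/
abbrev System (L : FirstOrder.Language.{u, v}) (V : Type w) := Set (L.Term V × L.Term V)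

/-- A term rewrite system: left-hand sides are not variables, and every variable of a right-hand
side occurs in the left-hand side. -/
def IsTRS (R : System L V) : Prop := ∀ e ∈ R, ¬ IsVar e.1 ∧ vars e.2 ⊆ vars e.1

/-- Left-linearity. -/
def LeftLinear (R : System L V) : Prop := ∀ e ∈ R, IsLinear e.1

/-- The set `E^±` of the equations in `E` and their reversals. -/
def pm (E : System L V) : System L V := {e | e ∈ E ∨ (e.2, e.1) ∈ E}

/-- The rewrite relation `→_E`. -/
def Rew (E : System L V) (s t : L.Term V) : Prop :=
  ∃ l r p σ, (l, r) ∈ E ∧ IsSubst σ ∧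
    subtermAt s p = some (l.subst σ) ∧ t = replaceAt s p (r.subst σ)

/-- The symmetric closure `↔_E` of the rewrite relation. -/
def SymRew (E : System L V) (s t : L.Term V) : Prop := Rew E s t ∨ Rew E t s

/-- The equational theory `∼ = ↔_B^*` of `B`. -/
def Sim (B : System L V) : L.Term V → L.Term V → Prop := Relation.ReflTransGen (SymRew B)

/-- Rewriting modulo `B`: the relation `→_{R/B} = ∼ · →_R · ∼`. -/
def RewMod (R B : System L V) : L.Term V → L.Term V → Prop :=
  Relation.Comp (Relation.Comp (Sim B) (Rew R)) (Sim B)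

/-- The valley relation `→_R^* · ∼ · ←_R^*`. -/
def Valley (R B : System L V) (s t : L.Term V) : Prop :=
  ∃ s' t', Relation.ReflTransGen (Rew R) s s' ∧ Sim B s' t' ∧ Relation.ReflTransGen (Rew R) t t'

/-- Conversions modulo `B`: the reflexive transitive closure of `←_R ∪ →_R ∪ ∼`. -/
def Conv (R B : System L V) : L.Term V → L.Term V → Prop :=
  Relation.ReflTransGen (fun s t => Rew R t s ∨ Rew R s t ∨ Sim B s t)

/-- `t` is a normal form of the relation `r`. -/
def IsNF (r : L.Term V → L.Term V → Prop) (t : L.Term V) : Prop := ∀ u, ¬ r t u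

/-- Termination modulo `B`: there is no infinite sequence of `→_{R/B}` steps. -/
def TerminatingModulo (R B : System L V) : Prop :=
  ¬ ∃ f : ℕ → L.Term V, ∀ n, RewMod R B (f n) (f (n + 1))

/-- The Church-Rosser property of `→_R` modulo `B`. -/
def ChurchRosserModulo (R B : System L V) : Prop := ∀ s t, Conv R B s t → Valley R B s t

/-- Completeness modulo `B`. -/
def CompleteModulo (R B : System L V) : Prop := TerminatingModulo R B ∧ ChurchRosserModulo R B

/-- The left-hand side of each rule is a normal form with respect to the other rules. -/
def LeftReduced (R : System L V) : Prop := ∀ e ∈ R, IsNF (Rew (R \ {e})) e.1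

/-- The right-hand side of each rule is a normal form with respect to `→_{R/B}`. -/
def RightReducedModulo (R B : System L V) : Prop := ∀ e ∈ R, IsNF (RewMod R B) e.2

/-- `R` is a term rewrite system that is canonical modulo `B`. -/
def CanonicalModulo (R B : System L V) : Prop :=
  IsTRS R ∧ CompleteModulo R B ∧ LeftReduced R ∧ RightReducedModulo R B

/-- A `B`-compatible reduction order `>` (written `gt`): a well-founded strict order that is closed
under contexts and substitutions and satisfies `∼ · > · ∼ ⊆ >`. -/
structure IsCompatibleReductionOrder (B : System L V) (gt : L.Term V → L.Term V → Prop) :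
    Prop where
  trans : ∀ s t u, gt s t → gt t u → gt s u
  wf : WellFounded (fun s t => gt t s)
  closed_context : ∀ c p s t, p ∈ positions c → gt s t → gt (replaceAt c p s) (replaceAt c p t)
  closed_subst : ∀ σ s t, IsSubst σ → gt s t → gt (s.subst σ) (t.subst σ)
  compatible : ∀ s s' t' t, Sim B s s' → gt s' t' → Sim B t' t → gt s t

end Systems

section CriticalPairs

variable {L : FirstOrder.Language.{u, v}} {V : Type w}

/-- The pairs `e` and `e'` are variants: a renaming turns `e` into `e'`. -/
def IsVariant (e e' : L.Term V × L.Term V) : Prop :=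
  ∃ π : Equiv.Perm V, IsRenaming π ∧
    e.1.subst (fun x => .var (π x)) = e'.1 ∧ e.2.subst (fun x => .var (π x)) = e'.2

/-- `⟨e₁, p, e₂⟩` is an overlap in which `e₁` stems from `R₁` and `e₂` stems from `R₂`. -/
structure IsOverlap (R₁ R₂ : System L V) (e₁ : L.Term V × L.Term V) (p : List ℕ)
    (e₂ : L.Term V × L.Term V) : Prop where
  left_variant : ∃ e ∈ R₁, IsVariant e e₁
  right_variant : ∃ e ∈ R₂, IsVariant e e₂
  disjoint : Disjoint (vars e₁.1 ∪ vars e₁.2) (vars e₂.1 ∪ vars e₂.2)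
  position : p ∈ funPositions e₂.1
  unifiable : ∃ u σ, subtermAt e₂.1 p = some u ∧ IsUnifier σ e₁.1 u
  root : p = [] → ¬ IsVariant e₁ e₂

/-- `t ←[p] s →[ε] u` is a critical peak obtained from an overlap `⟨e₁, p, e₂⟩` with `e₁` from `R₁`
and `e₂` from `R₂`. -/
def CriticalPeak (R₁ R₂ : System L V) (t : L.Term V) (p : List ℕ) (s u : L.Term V) : Prop :=
  ∃ e₁ e₂ v σ, IsOverlap R₁ R₂ e₁ p e₂ ∧ subtermAt e₂.1 p = some v ∧ IsMGU σ e₁.1 v ∧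
    t = replaceAt (e₂.1.subst σ) p (e₁.2.subst σ) ∧ s = e₂.1.subst σ ∧ u = e₂.2.subst σ

/-- All proper subterms of `s|_p` are normal forms of `→_R`. -/
def PrimeAt (R : System L V) (s : L.Term V) (p : List ℕ) : Prop :=
  ∀ v q v', subtermAt s p = some v → q ≠ [] → subtermAt v q = some v' → IsNF (Rew R) v'

/-- The set `PCP(R)` of prime critical pairs of `R`. -/
def PCP (R : System L V) : System L V :=
  {e | ∃ p s, CriticalPeak R R e.1 p s e.2 ∧ PrimeAt R s p}

/-- The set `PCP^±(R, B^±)` of the critical pairs between `R` and `B^±`, in both directions, that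
are prime with respect to `R`. -/
def PCPpm (R B : System L V) : System L V :=
  {e | ∃ p s, (CriticalPeak R (pm B) e.1 p s e.2 ∨ CriticalPeak (pm B) R e.1 p s e.2) ∧
    PrimeAt R s p}

end CriticalPairs

section Inference

variable {L : FirstOrder.Language.{u, v}} {V : Type w}

/-- The pairs `(E, R)` transformed by the inference system. -/
abbrev State (L : FirstOrder.Language.{u, v}) (V : Type w) := System L V × System L V

/-- Deduce: `(E, R) ⇒ (E ∪ {s ≈ t}, R)` if `s ←_R · →_{R ∪ B^±} t`. -/
def Deduce (B : System L V) (S S' : State L V) : Prop :=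
  ∃ c s t, Rew S.2 c s ∧ Rew (S.2 ∪ pm B) c t ∧ S' = (S.1 ∪ {(s, t)}, S.2)

/-- Orient: `(E ⊎ {s ≈ t}, R) ⇒ (E, R ∪ {s → t})`, and likewise from `(E ⊎ {t ≈ s}, R)`,
if `s > t`. -/
def Orient (gt : L.Term V → L.Term V → Prop) (S S' : State L V) : Prop :=
  ∃ e s t, (e = (s, t) ∨ e = (t, s)) ∧ e ∈ S.1 ∧ gt s t ∧ S' = (S.1 \ {e}, S.2 ∪ {(s, t)})

/-- Delete: `(E ⊎ {s ≈ t}, R) ⇒ (E, R)` if `s ∼ t`. -/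
def Delete (B : System L V) (S S' : State L V) : Prop :=
  ∃ s t, (s, t) ∈ S.1 ∧ Sim B s t ∧ S' = (S.1 \ {(s, t)}, S.2)

/-- Simplify: `(E ⊎ {s ≈ t}, R) ⇒ (E ∪ {u ≈ t}, R)`, and likewise from `(E ⊎ {t ≈ s}, R)`,
if `s →_R u`. -/
def Simplify (S S' : State L V) : Prop :=
  ∃ e s t u, (e = (s, t) ∨ e = (t, s)) ∧ e ∈ S.1 ∧ Rew S.2 s u ∧
    S' = ((S.1 \ {e}) ∪ {(u, t)}, S.2)

/-- Collapse: `(E, R ⊎ {s → t}) ⇒ (E ∪ {u ≈ t}, R)` if `s →_R u`. -/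
def Collapse (S S' : State L V) : Prop :=
  ∃ s t u, (s, t) ∈ S.2 ∧ Rew (S.2 \ {(s, t)}) s u ∧ S' = (S.1 ∪ {(u, t)}, S.2 \ {(s, t)})

/-- Compose: `(E, R ⊎ {s → t}) ⇒ (E, R ∪ {s → u})` if `t →_R u`. -/
def Compose (S S' : State L V) : Prop :=
  ∃ s t u, (s, t) ∈ S.2 ∧ Rew (S.2 \ {(s, t)}) t u ∧ S' = (S.1, (S.2 \ {(s, t)}) ∪ {(s, u)})

/-- One step of the inference system `I_B`. -/
inductive StepIB (B : System L V) (gt : L.Term V → L.Term V → Prop) (S S' : State L V) : Prop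
  | deduce (h : Deduce B S S')
  | orient (h : Orient gt S S')
  | delete (h : Delete B S S')
  | simplify (h : Simplify S S')
  | collapse (h : Collapse S S')
  | compose (h : Compose S S')

/-- `S 0, …, S n` is a run for `E` in `I_B` (the values of `S` beyond `n` are irrelevant). -/
def IsRun (B : System L V) (gt : L.Term V → L.Term V → Prop) (E : System L V) (n : ℕ)
    (S : ℕ → State L V) : Prop :=
  S 0 = (E, ∅) ∧ ∀ i < n, StepIB B gt (S i) (S (i + 1))

/-- Fairness of a run `S 0, …, S n` in `I_B`. -/
def IsFair (B : System L V) (n : ℕ) (S : ℕ → State L V) : Prop :=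
  LeftLinear (S n).2 ∧
    ∀ e ∈ PCP (S n).2 ∪ PCPpm (S n).2 B,
      Valley (S n).2 B e.1 e.2 ∨ ∃ i ≤ n, SymRew (S i).1 e.1 e.2

end Inference

end CompletionModulo

open CompletionModulo

/-!
The proof has two halves: a critical pair criterion for confluence modulo `B`, and a simulation of
the whole run by its final system `R`.

**Prime critical peaks suffice.**  `Resolves R B Res` says that `Res` is a symmetric relation that
is closed under contexts and substitutions and contains all valleys and all prime critical pairs.
For every local peak or cliff `t ← s → u` (the right step with `R` or with `B^±`) there is then
a term `v` with `s →_R v`, `Res t v` and `Res v u` (`Resolves.local_peak`).  If the overlap is prime,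
`v` is `t` or `u`.  Otherwise `v` is obtained by contracting an innermost redex below the inner step,
which makes the overlaps of the new step with both given steps prime.  Variable overlaps are valleys;
this uses left-linearity of `R`.  Critical overlaps are instances of critical peaks, by renaming
apart and the existence of most general unifiers (`exists_isMGU`).

**Simulation.**  By induction from the end of the run backwards (`IsRun.simulated`), a rule `s → t`
of any intermediate system satisfies `s →_R w` for some `w` convertible to `t` through terms
smaller than `s` (`SimulatedStep`), and an equation `s ≈ t` of any intermediate state satisfies
`SimulatedEq`: either `s ∼ t`, or `s` and `t` are convertible below `s` and `t` in such a way that the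
larger of the two is left by a rewrite step.  Fairness hence makes `SimulatedEq` a relation that
resolves the prime critical pairs (`IsFair.resolves`).

**Conclusion.**  A local peak `t ← s → u` thus has a conversion through terms smaller than `s`.  In
a local cliff `t ← s ↔_B u` the reduct `v` of `s` satisfies `u > v`, so `SimulatedEq v u`
supplies a rewrite step from `u`: there is `u →_R u'` with `t` and `u'` convertible below `s`.  These
two properties give the Church-Rosser property by well-founded induction
(`churchRosserModulo_of_local`).  Termination and the variable conditions hold because all rules are
contained in `>`.  Left-reducedness says that collapse does not apply; right-reducedness follows from
the fact that compose does not apply and the Church-Rosser property (`rightReducedModulo`).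
-/

namespace CompletionModulo

open FirstOrder.Language

/-! ### Terms, positions and substitutions -/

section Terms

variable {L : FirstOrder.Language.{u, v}} {V : Type w}

@[simp] theorem mem_vars_var {x y : V} : y ∈ vars (.var x : L.Term V) ↔ y = x := by
  simp [vars, Term.varFinset]

@[simp] theorem mem_vars_func {n : ℕ} {f : L.Functions n} {ts : Fin n → L.Term V} {y : V} :
    y ∈ vars (.func f ts) ↔ ∃ i, y ∈ vars (ts i) := by
  simp [vars, Term.varFinset]

theorem finite_vars (t : L.Term V) : (vars t).Finite := by
  classical exact Finset.finite_toSet _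

@[simp] theorem subtermAt_nil (t : L.Term V) : subtermAt t [] = some t := by
  cases t <;> rfl

@[simp] theorem replaceAt_nil (t u : L.Term V) : replaceAt t [] u = u := by
  cases t <;> rfl

@[simp] theorem subtermAt_var_cons (x : V) (i : ℕ) (p : List ℕ) :
    subtermAt (.var x : L.Term V) (i :: p) = none := rfl

theorem subtermAt_func_cons {n : ℕ} {f : L.Functions n} {ts : Fin n → L.Term V} {i : ℕ}
    {p : List ℕ} {u : L.Term V} :
    subtermAt (.func f ts) (i :: p) = some u ↔ ∃ h : i < n, subtermAt (ts ⟨i, h⟩) p = some u := by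
  simp only [subtermAt]
  split <;> simp_all

theorem replaceAt_func_cons {n : ℕ} {f : L.Functions n} {ts : Fin n → L.Term V} (i : Fin n)
    (p : List ℕ) (u : L.Term V) :
    replaceAt (.func f ts) ((i : ℕ) :: p) u =
      .func f (Function.update ts i (replaceAt (ts i) p u)) := by
  simp only [replaceAt, Term.func.injEq, heq_eq_eq, true_and]
  funext j
  by_cases h : j = i
  · subst h; simp
  · simp [h, Fin.val_inj]

/-- Induction on the position of a subterm. -/
theorem subtermAt_induction {u : L.Term V}
    {P : (t : L.Term V) → (p : List ℕ) → subtermAt t p = some u → Prop}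
    (root : P u [] (subtermAt_nil u))
    (arg : ∀ {n : ℕ} (f : L.Functions n) (ts : Fin n → L.Term V) (i : Fin n) (p : List ℕ)
      (h : subtermAt (ts i) p = some u), P (ts i) p h →
        P (.func f ts) (i :: p) (subtermAt_func_cons.2 ⟨i.2, h⟩))
    {t : L.Term V} {p : List ℕ} (h : subtermAt t p = some u) : P t p h := by
  induction p generalizing t with
  | nil => obtain rfl : t = u := by simpa using h
           exact root
  | cons i p ih =>
    cases t with
    | var x => simp at h
    | func f ts =>
      obtain ⟨hi, h⟩ := subtermAt_func_cons.1 h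
      exact arg f ts ⟨i, hi⟩ p h (ih h)

theorem subtermAt_append {t u : L.Term V} {p : List ℕ} (h : subtermAt t p = some u)
    (q : List ℕ) : subtermAt t (p ++ q) = subtermAt u q := by
  induction h using subtermAt_induction with
  | root => rfl
  | arg f ts i p h ih => simp [subtermAt, ih]

theorem replaceAt_append {t u : L.Term V} {p : List ℕ} (h : subtermAt t p = some u)
    (q : List ℕ) (v : L.Term V) : replaceAt t (p ++ q) v = replaceAt t p (replaceAt u q v) := by
  induction h using subtermAt_induction with
  | root => simp
  | arg f ts i p h ih => rw [List.cons_append, replaceAt_func_cons, replaceAt_func_cons, ih]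

theorem subtermAt_replaceAt {t u : L.Term V} {p : List ℕ} (h : subtermAt t p = some u)
    (v : L.Term V) : subtermAt (replaceAt t p v) p = some v := by
  induction h using subtermAt_induction with
  | root => simp
  | arg f ts i p h ih =>
    rw [replaceAt_func_cons, subtermAt_func_cons]
    exact ⟨i.2, by simpa using ih⟩

theorem replaceAt_replaceAt {t u : L.Term V} {p : List ℕ} (h : subtermAt t p = some u)
    (v w : L.Term V) : replaceAt (replaceAt t p v) p w = replaceAt t p w := by
  induction h using subtermAt_induction with
  | root => simp
  | arg f ts i p h ih => simp [replaceAt_func_cons, ih]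

theorem replaceAt_self {t u : L.Term V} {p : List ℕ} (h : subtermAt t p = some u) :
    replaceAt t p u = t := by
  induction h using subtermAt_induction with
  | root => simp
  | arg f ts i p h ih => simp [replaceAt_func_cons, ih]

theorem subtermAt_subst {t u : L.Term V} {p : List ℕ} (h : subtermAt t p = some u)
    (σ : V → L.Term V) : subtermAt (t.subst σ) p = some (u.subst σ) := by
  induction h using subtermAt_induction with
  | root => simp
  | arg f ts i p h ih => exact subtermAt_func_cons.2 ⟨i.2, ih⟩

theorem replaceAt_subst {t u : L.Term V} {p : List ℕ} (h : subtermAt t p = some u)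
    (v : L.Term V) (σ : V → L.Term V) :
    (replaceAt t p v).subst σ = replaceAt (t.subst σ) p (v.subst σ) := by
  induction h using subtermAt_induction with
  | root => simp
  | arg f ts i p h ih =>
    simp only [replaceAt_func_cons, Term.subst, Term.func.injEq, heq_eq_eq, true_and]
    funext j
    by_cases hj : j = i
    · subst hj; simpa using ih
    · simp [hj]

/-- A position of `t.subst σ` is a function position of `t` or lies at or below a variable position
of `t`. -/
theorem position_subst {t v : L.Term V} {σ : V → L.Term V} {p : List ℕ}
    (h : subtermAt (t.subst σ) p = some v) :
    (∃ u, subtermAt t p = some u ∧ ¬ IsVar u ∧ v = u.subst σ) ∨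
      ∃ o q x, p = o ++ q ∧ subtermAt t o = some (.var x) ∧ subtermAt (σ x) q = some v := by
  induction p generalizing t with
  | nil =>
    cases t with
    | var x => exact .inr ⟨[], [], x, by simp, by simp, h⟩
    | func f ts =>
      refine .inl ⟨_, subtermAt_nil _, ?_, by simpa using h.symm⟩
      rintro ⟨x, hx⟩; cases hx
  | cons i p ih =>
    cases t with
    | var x => exact .inr ⟨[], i :: p, x, by simp, by simp, h⟩
    | func f ts =>
      obtain ⟨hi, h⟩ := subtermAt_func_cons.1 h
      obtain ⟨u, hu, hv⟩ | ⟨o, q, x, rfl, hx, hq⟩ := ih h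
      · exact .inl ⟨u, subtermAt_func_cons.2 ⟨hi, hu⟩, hv⟩
      · exact .inr ⟨i :: o, q, x, by simp, subtermAt_func_cons.2 ⟨hi, hx⟩, hq⟩

theorem mem_vars_of_subtermAt {t u : L.Term V} {p : List ℕ} (h : subtermAt t p = some u) {x : V}
    (hx : x ∈ vars u) : x ∈ vars t := by
  induction h using subtermAt_induction with
  | root => exact hx
  | arg f ts i p h ih => exact mem_vars_func.2 ⟨i, ih⟩

theorem exists_position_of_mem_vars {t : L.Term V} {x : V} (h : x ∈ vars t) :
    ∃ p, subtermAt t p = some (.var x) := by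
  induction t with
  | var y => exact ⟨[], by simp_all⟩
  | func f ts ih =>
    obtain ⟨i, hi⟩ := mem_vars_func.1 h
    obtain ⟨p, hp⟩ := ih i hi
    exact ⟨i :: p, subtermAt_func_cons.2 ⟨i.2, hp⟩⟩

theorem subst_congr {t : L.Term V} {σ τ : V → L.Term V} (h : ∀ x ∈ vars t, σ x = τ x) :
    t.subst σ = t.subst τ := by
  induction t with
  | var x => exact h x (by simp)
  | func f ts ih =>
    simp only [Term.subst, Term.func.injEq, heq_eq_eq, true_and]
    funext i
    exact ih i fun x hx => h x (mem_vars_func.2 ⟨i, hx⟩)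

theorem eq_of_subst_eq {t : L.Term V} {σ τ : V → L.Term V} (h : t.subst σ = t.subst τ) {x : V}
    (hx : x ∈ vars t) : σ x = τ x := by
  induction t with
  | var y => obtain rfl := mem_vars_var.1 hx; exact h
  | func f ts ih =>
    obtain ⟨i, hi⟩ := mem_vars_func.1 hx
    simp only [Term.subst, Term.func.injEq, heq_eq_eq, true_and] at h
    exact ih i (congrFun h i) hi

theorem subst_subst (t : L.Term V) (σ τ : V → L.Term V) :
    (t.subst σ).subst τ = t.subst fun x => (σ x).subst τ := by
  induction t with
  | var x => rfl
  | func f ts ih => simp [Term.subst, ih]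

@[simp] theorem subst_var (t : L.Term V) : t.subst .var = t := by
  induction t with
  | var x => rfl
  | func f ts ih => simp [Term.subst, ih]

theorem mem_vars_subst {t : L.Term V} {σ : V → L.Term V} {y : V} :
    y ∈ vars (t.subst σ) ↔ ∃ x ∈ vars t, y ∈ vars (σ x) := by
  induction t with
  | var x => simp [Term.subst]
  | func f ts ih => simp only [Term.subst, mem_vars_func, ih]; grind

theorem isSubst_var : IsSubst (.var : V → L.Term V) := by simp [IsSubst]

open Classical in
/-- The restriction of a map from variables to terms to the variables in a set `A`: variables
outside of `A` are fixed. -/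
noncomputable def restrictSubst (A : Set V) (σ : V → L.Term V) : V → L.Term V :=
  fun x => if x ∈ A then σ x else .var x

theorem isSubst_restrictSubst {A : Set V} (hA : A.Finite) (σ : V → L.Term V) :
    IsSubst (restrictSubst A σ) := by
  refine hA.subset fun x hx => ?_
  by_contra h
  simp [restrictSubst, h] at hx

theorem subst_restrictSubst {A : Set V} {t : L.Term V} (h : vars t ⊆ A) (σ : V → L.Term V) :
    t.subst (restrictSubst A σ) = t.subst σ :=
  subst_congr fun x hx => by simp [restrictSubst, h hx]

theorem IsSubst.comp {σ τ : V → L.Term V} (hσ : IsSubst σ) (hτ : IsSubst τ) :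
    IsSubst fun x => (σ x).subst τ := by
  refine (Set.Finite.union hσ hτ).subset fun x hx => ?_
  by_contra h
  simp only [Set.mem_union, Set.mem_ofPred_eq, not_or, not_not] at h
  simp [h.1, h.2, Term.subst] at hx

theorem isSubst_update [DecidableEq V] (x : V) (t : L.Term V) :
    IsSubst (Function.update .var x t) := by
  refine (Set.finite_singleton x).subset fun y hy => ?_
  by_contra h
  exact hy (Function.update_of_ne h _ _)

end Terms

/-! ### Rewriting under contexts and substitutions -/

section Rewriting

variable {L : FirstOrder.Language.{u, v}} {V : Type w} {E R B : System L V}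

/-- A relation on terms that is closed under contexts. -/
def ClosedContext (r : L.Term V → L.Term V → Prop) : Prop :=
  ∀ c p s t, p ∈ positions c → r s t → r (replaceAt c p s) (replaceAt c p t)

/-- A relation on terms that is closed under substitutions. -/
def ClosedSubst (r : L.Term V → L.Term V → Prop) : Prop :=
  ∀ σ s t, IsSubst σ → r s t → r (s.subst σ) (t.subst σ)

/-- The finiteness of the substitution in a rewrite step is no restriction. -/
theorem Rew.of_subterm {l r : L.Term V} (h : (l, r) ∈ E) {s : L.Term V} {p : List ℕ}
    {σ : V → L.Term V} (hs : subtermAt s p = some (l.subst σ)) :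
    Rew E s (replaceAt s p (r.subst σ)) := by
  refine ⟨l, r, p, restrictSubst (vars l ∪ vars r) σ, h,
    isSubst_restrictSubst ((finite_vars l).union (finite_vars r)) σ, ?_, ?_⟩
  · rw [subst_restrictSubst Set.subset_union_left, hs]
  · rw [subst_restrictSubst Set.subset_union_right]

theorem Rew.of_subst {l r : L.Term V} (h : (l, r) ∈ E) (σ : V → L.Term V) :
    Rew E (l.subst σ) (r.subst σ) := by
  simpa using Rew.of_subterm h (subtermAt_nil (l.subst σ))

theorem Rew.of_mem {l r : L.Term V} (h : (l, r) ∈ E) : Rew E l r := by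
  simpa using Rew.of_subst h .var

theorem Rew.mono {E' : System L V} (hE : E ⊆ E') {s t : L.Term V} (h : Rew E s t) : Rew E' s t := by
  obtain ⟨l, r, p, σ, hlr, h⟩ := h
  exact ⟨l, r, p, σ, hE hlr, h⟩

theorem closedContext_rew : ClosedContext (Rew E) := by
  rintro c p s t ⟨u, hu⟩ ⟨l, r, q, σ, hlr, hσ, hs, rfl⟩
  refine ⟨l, r, p ++ q, σ, hlr, hσ, ?_, ?_⟩
  · rw [subtermAt_append (subtermAt_replaceAt hu s), hs]
  · rw [replaceAt_append (subtermAt_replaceAt hu s), replaceAt_replaceAt hu]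

theorem closedSubst_rew : ClosedSubst (Rew E) := by
  rintro τ s t hτ ⟨l, r, q, σ, hlr, hσ, hs, rfl⟩
  refine ⟨l, r, q, _, hlr, hσ.comp hτ, ?_, ?_⟩
  · rw [subtermAt_subst hs, subst_subst]
  · rw [replaceAt_subst hs, subst_subst]

/-- A relation closed under contexts and substitutions that contains `E` contains `→_E`. -/
theorem Rew.rel {r : L.Term V → L.Term V → Prop} (hc : ClosedContext r) (hs : ClosedSubst r)
    (hE : ∀ s t, (s, t) ∈ E → r s t) {s t : L.Term V} (h : Rew E s t) : r s t := by
  obtain ⟨l, r', p, σ, hlr, hσ, hp, rfl⟩ := h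
  simpa [replaceAt_self hp] using hc s p _ _ ⟨_, hp⟩ (hs σ _ _ hσ (hE _ _ hlr))

theorem ClosedContext.reflTransGen {r : L.Term V → L.Term V → Prop} (h : ClosedContext r) :
    ClosedContext (Relation.ReflTransGen r) := fun c p _ _ hp hst =>
  hst.lift (fun s => replaceAt c p s) fun _ _ => h c p _ _ hp

theorem ClosedSubst.reflTransGen {r : L.Term V → L.Term V → Prop} (h : ClosedSubst r) :
    ClosedSubst (Relation.ReflTransGen r) := fun σ _ _ hσ hst =>
  hst.lift (fun s => s.subst σ) fun _ _ => h σ _ _ hσ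

theorem closedContext_symRew : ClosedContext (SymRew E) := fun c p s t hp h =>
  h.imp (closedContext_rew c p s t hp) (closedContext_rew c p t s hp)

theorem closedSubst_symRew : ClosedSubst (SymRew E) := fun σ s t hσ h =>
  h.imp (closedSubst_rew σ s t hσ) (closedSubst_rew σ t s hσ)

theorem closedContext_sim : ClosedContext (Sim B) := closedContext_symRew.reflTransGen

theorem closedSubst_sim : ClosedSubst (Sim B) := closedSubst_symRew.reflTransGen

instance : Std.Symm (SymRew E) := ⟨fun _ _ => Or.symm⟩

theorem Sim.symm {s t : L.Term V} (h : Sim B s t) : Sim B t s :=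
  symm_of (Relation.ReflTransGen (SymRew B)) h

theorem Sim.trans {s t u : L.Term V} (h : Sim B s t) (h' : Sim B t u) : Sim B s u :=
  Relation.ReflTransGen.trans h h'

theorem rew_pm {s t : L.Term V} : Rew (pm B) s t ↔ SymRew B s t := by
  constructor
  · refine Rew.rel closedContext_symRew closedSubst_symRew ?_
    rintro s t (h | h)
    exacts [.inl (.of_mem h), .inr (.of_mem h)]
  · rintro (h | h)
    · exact h.mono fun e => .inl
    · refine Rew.rel (r := fun t s => Rew (pm B) s t) (fun c p s t => closedContext_rew c p t s)
        (fun σ s t => closedSubst_rew σ t s) (fun s t h => .of_mem (.inr h)) h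

theorem Sim.of_rew_pm {s t : L.Term V} (h : Rew (pm B) s t) : Sim B s t :=
  .single (rew_pm.1 h)

theorem Valley.refl (s : L.Term V) : Valley R B s s := ⟨s, s, .refl, .refl, .refl⟩

theorem Valley.symm {s t : L.Term V} (h : Valley R B s t) : Valley R B t s := by
  obtain ⟨s', t', hs, h, ht⟩ := h
  exact ⟨t', s', ht, h.symm, hs⟩

theorem reflTransGen_func {r : L.Term V → L.Term V → Prop} (hr : ClosedContext r) {n : ℕ}
    (f : L.Functions n) {ss ts : Fin n → L.Term V}
    (h : ∀ i, Relation.ReflTransGen r (ss i) (ts i)) :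
    Relation.ReflTransGen r (.func f ss) (.func f ts) := by
  -- The arguments are rewritten one after the other, those with the indices in `A` first.
  suffices H : ∀ A : Finset (Fin n), Relation.ReflTransGen r (.func f ss)
      (.func f fun i => if i ∈ A then ts i else ss i) by
    simpa using H Finset.univ
  intro A
  induction A using Finset.induction_on with
  | empty => simpa using Relation.ReflTransGen.refl
  | insert a A ha ihA =>
    refine ihA.trans ?_
    let us : Fin n → L.Term V := fun i => if i ∈ A then ts i else ss i
    have hpos : subtermAt (.func f us) [(a : ℕ)] = some (us a) :=
      subtermAt_func_cons.2 ⟨a.2, by simp⟩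
    have := hr.reflTransGen (.func f us) [(a : ℕ)] _ _ ⟨_, hpos⟩ (h a)
    convert this using 1
    · refine (replaceAt_self (hpos.trans ?_)).symm
      simp [us, ha]
    · rw [replaceAt_func_cons, Term.func.injEq]
      refine ⟨rfl, HEq.rfl, heq_of_eq (funext fun i => ?_)⟩
      by_cases hi : i = a
      · subst hi; simp
      · simp [hi, us]

/-- Pointwise related substitutions yield related instances. -/
theorem reflTransGen_subst {r : L.Term V → L.Term V → Prop} (hr : ClosedContext r)
    (t : L.Term V) {σ τ : V → L.Term V} (h : ∀ x, Relation.ReflTransGen r (σ x) (τ x)) :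
    Relation.ReflTransGen r (t.subst σ) (t.subst τ) := by
  induction t with
  | var x => exact h x
  | func f ts ih => exact reflTransGen_func hr f ih

end Rewriting

/-! ### Unification and renaming -/

section Unification

variable {L : FirstOrder.Language.{u, v}} {V : Type w}

/-- The number of occurrences of variables and function symbols in a term. -/
def termSize : L.Term V → ℕ
  | .var _ => 1
  | .func _ ts => 1 + ∑ i, termSize (ts i)

/-- The total size of a list of equations. -/
def eqsSize (P : List (L.Term V × L.Term V)) : ℕ := (P.map fun e => termSize e.1 + termSize e.2).sum

/-- The variables of a list of equations. -/
def eqsVars (P : List (L.Term V × L.Term V)) : Set V := {x | ∃ e ∈ P, x ∈ vars e.1 ∪ vars e.2}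

/-- `τ` solves all equations of a list. -/
def Solves (τ : V → L.Term V) (P : List (L.Term V × L.Term V)) : Prop :=
  ∀ e ∈ P, e.1.subst τ = e.2.subst τ

/-- If the equations have a solution, then they have an idempotent most general solution. -/
def HasPrincipalSolution (P : List (L.Term V × L.Term V)) : Prop :=
  (∃ τ : V → L.Term V, Solves τ P) →
    ∃ σ, IsSubst σ ∧ Solves σ P ∧ ∀ τ, Solves τ P → ∀ x, (σ x).subst τ = τ x

theorem termSize_pos (t : L.Term V) : 0 < termSize t := by
  cases t <;> simp [termSize]

theorem finite_eqsVars (P : List (L.Term V × L.Term V)) : (eqsVars P).Finite := by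
  have : eqsVars P = ⋃ e ∈ {e | e ∈ P}, (vars e.1 ∪ vars e.2) := by ext; simp [eqsVars]
  rw [this]
  exact (List.finite_toSet P).biUnion fun e _ => (finite_vars _).union (finite_vars _)

theorem termSize_le_of_mem_vars {t : L.Term V} {x : V} (h : x ∈ vars t) (τ : V → L.Term V) :
    termSize (τ x) ≤ termSize (t.subst τ) := by
  induction t with
  | var y => obtain rfl := mem_vars_var.1 h; rfl
  | func f ts ih =>
    obtain ⟨i, hi⟩ := mem_vars_func.1 h
    have := Finset.single_le_sum (f := fun i => termSize ((ts i).subst τ))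
      (fun _ _ => Nat.zero_le _) (Finset.mem_univ i)
    have := ih i hi
    simp only [Term.subst, termSize]
    omega

/-- Occurs check: a variable has no common instance with a larger term containing it. -/
theorem not_mem_vars_of_subst_eq {x : V} {t : L.Term V} (hx : t ≠ .var x) {τ : V → L.Term V}
    (h : τ x = t.subst τ) : x ∉ vars t := by
  cases t with
  | var y => rintro hy; obtain rfl := mem_vars_var.1 hy; exact hx rfl
  | func f ts =>
    rintro hy
    obtain ⟨i, hi⟩ := mem_vars_func.1 hy
    have h1 := termSize_le_of_mem_vars hi τ
    have h2 := Finset.single_le_sum (f := fun i => termSize ((ts i).subst τ))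
      (fun _ _ => Nat.zero_le _) (Finset.mem_univ i)
    rw [h] at h1
    simp only [Term.subst, termSize] at h1
    omega

/-- Solving `x ≈ t` for `x` eliminates `x` from the remaining equations. -/
theorem hasPrincipalSolution_elim {x : V} {t : L.Term V} {P : List (L.Term V × L.Term V)}
    (ih : ∀ Q : List (L.Term V × L.Term V),
      (eqsVars Q).ncard < (eqsVars ((.var x, t) :: P)).ncard → HasPrincipalSolution Q)
    (hxt : t ≠ .var x) : HasPrincipalSolution ((.var x, t) :: P) := by
  classical
  rintro ⟨τ₀, hτ₀⟩
  have hx : x ∉ vars t := not_mem_vars_of_subst_eq hxt (hτ₀ _ List.mem_cons_self)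
  set δ : V → L.Term V := Function.update .var x t with hδ
  let Q := P.map fun e => (e.1.subst δ, e.2.subst δ)
  -- Every solution factors through `δ`.
  have key : ∀ τ : V → L.Term V, Solves τ ((.var x, t) :: P) → ∀ y, (δ y).subst τ = τ y := by
    intro τ hτ y
    by_cases hy : y = x
    · subst hy
      simpa [hδ] using (hτ _ List.mem_cons_self).symm
    · simp [hδ, hy, Term.subst]
  have solQ : ∀ τ : V → L.Term V, Solves τ ((.var x, t) :: P) → Solves τ Q := by
    intro τ hτ e he
    obtain ⟨e, heP, rfl⟩ := List.mem_map.1 he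
    simp only [subst_subst, key τ hτ]
    exact hτ _ (List.mem_cons_of_mem _ heP)
  have varsδ : ∀ s : L.Term V, ∀ y ∈ vars (s.subst δ), y ≠ x ∧ (y ∈ vars s ∨ y ∈ vars t) := by
    intro s y hy
    obtain ⟨z, hz, hy⟩ := mem_vars_subst.1 hy
    by_cases hzx : z = x
    · subst hzx
      simp only [hδ, Function.update_self] at hy
      exact ⟨fun h => hx (h ▸ hy), .inr hy⟩
    · simp only [hδ, Function.update_of_ne hzx, mem_vars_var] at hy
      subst hy
      exact ⟨hzx, .inl hz⟩
  have hlt : (eqsVars Q).ncard < (eqsVars ((.var x, t) :: P)).ncard := by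
    refine Set.ncard_lt_ncard ⟨?_, ?_⟩ (finite_eqsVars _)
    · rintro y ⟨e, he, hy⟩
      obtain ⟨e, heP, rfl⟩ := List.mem_map.1 he
      have h : y ∈ vars e.1 ∨ y ∈ vars e.2 ∨ y ∈ vars t := by
        rcases hy with hy | hy <;> have := (varsδ _ _ hy).2 <;> tauto
      rcases h with h | h | h
      · exact ⟨e, List.mem_cons_of_mem _ heP, .inl h⟩
      · exact ⟨e, List.mem_cons_of_mem _ heP, .inr h⟩
      · exact ⟨_, List.mem_cons_self, .inr h⟩
    · intro h
      obtain ⟨e, he, hy⟩ := h ⟨_, List.mem_cons_self, .inl (mem_vars_var.2 rfl)⟩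
      obtain ⟨e, heP, rfl⟩ := List.mem_map.1 he
      rcases hy with hy | hy <;> exact (varsδ _ _ hy).1 rfl
  obtain ⟨σ, hσ, hσQ, hσm⟩ := ih Q hlt ⟨τ₀, solQ τ₀ hτ₀⟩
  refine ⟨fun y => (δ y).subst σ, (isSubst_update x t).comp hσ, ?_, ?_⟩
  · intro e he
    rcases List.mem_cons.1 he with rfl | he
    · have : t.subst (fun y => (δ y).subst σ) = t.subst σ := subst_congr fun y hy => by
        have : y ≠ x := fun h => hx (h ▸ hy)
        simp [hδ, this, Term.subst]
      rw [this]
      simp [Term.subst, hδ]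
    · have := hσQ _ (List.mem_map.2 ⟨e, he, rfl⟩)
      simpa only [subst_subst] using this
  · intro τ hτ y
    rw [subst_subst, ← key τ hτ y]
    exact subst_congr fun z _ => hσm τ (solQ τ hτ) z

theorem hasPrincipalSolution_of_iff {P Q : List (L.Term V × L.Term V)}
    (h : ∀ τ : V → L.Term V, Solves τ P ↔ Solves τ Q) (hQ : HasPrincipalSolution Q) :
    HasPrincipalSolution P := by
  simpa only [HasPrincipalSolution, h] using hQ

/-- A step of the unification algorithm: it decreases the number of variables, or it decreases the
size without introducing new variables. -/
theorem hasPrincipalSolution_step (P : List (L.Term V × L.Term V))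
    (ih : ∀ Q : List (L.Term V × L.Term V), (eqsVars Q).ncard < (eqsVars P).ncard ∨
      (eqsVars Q ⊆ eqsVars P ∧ eqsSize Q < eqsSize P) → HasPrincipalSolution Q) :
    HasPrincipalSolution P := by
  match P with
  | [] => exact fun _ => ⟨.var, isSubst_var, by simp [Solves], fun _ _ _ => rfl⟩
  | (s, t) :: P =>
    by_cases hst : s = t
    · subst hst
      refine hasPrincipalSolution_of_iff (Q := P) (by simp [Solves]) (ih P (.inr ⟨?_, ?_⟩))
      · rintro y ⟨e, he, hy⟩
        exact ⟨e, List.mem_cons_of_mem _ he, hy⟩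
      · have := termSize_pos s
        simp [eqsSize]; omega
    cases s with
    | var x => exact hasPrincipalSolution_elim (fun Q hQ => ih Q (.inl hQ)) (Ne.symm hst)
    | @func n f ss =>
      cases t with
      | var x =>
        refine hasPrincipalSolution_of_iff (Q := (.var x, .func f ss) :: P)
          (by simp [Solves, eq_comm])
          (hasPrincipalSolution_elim (fun Q hQ => ih Q (.inl (hQ.trans_eq ?_))) hst)
        congr 1
        ext y
        simp [eqsVars, or_comm]
      | @func m g ts =>
        rintro ⟨τ₀, hτ₀⟩
        have h := hτ₀ _ List.mem_cons_self
        simp only [Term.subst, Term.func.injEq] at h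
        obtain ⟨rfl, h, -⟩ := h
        obtain rfl := eq_of_heq h
        have hiff : ∀ τ : V → L.Term V, Solves τ ((.func f ss, .func f ts) :: P) ↔
            Solves τ (List.ofFn (fun i => (ss i, ts i)) ++ P) := by
          intro τ
          simp only [Solves, List.mem_cons, List.mem_append, List.mem_ofFn, or_imp, forall_and,
            forall_eq, Term.subst, Term.func.injEq, heq_eq_eq, true_and, funext_iff,
            forall_exists_index, forall_apply_eq_imp_iff]
        refine hasPrincipalSolution_of_iff hiff (ih _ (.inr ⟨?_, ?_⟩)) ⟨τ₀, hτ₀⟩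
        · rintro y ⟨e, he, hy⟩
          rcases List.mem_append.1 he with he | he
          · obtain ⟨i, rfl⟩ := List.mem_ofFn.1 he
            exact ⟨_, List.mem_cons_self, hy.imp (fun h => mem_vars_func.2 ⟨i, h⟩)
              (fun h => mem_vars_func.2 ⟨i, h⟩)⟩
          · exact ⟨e, List.mem_cons_of_mem _ he, hy⟩
        · simp [eqsSize, termSize, List.map_ofFn, List.sum_ofFn, Finset.sum_add_distrib]
          omega

theorem hasPrincipalSolution (P : List (L.Term V × L.Term V)) : HasPrincipalSolution P := by
  suffices H : ∀ n m : ℕ, ∀ P : List (L.Term V × L.Term V), (eqsVars P).ncard = n →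
      eqsSize P = m → HasPrincipalSolution P from H _ _ P rfl rfl
  intro n
  induction n using Nat.strong_induction_on with
  | _ n ihn =>
    intro m
    induction m using Nat.strong_induction_on with
    | _ m ihm =>
      rintro P rfl rfl
      refine hasPrincipalSolution_step P fun Q hQ => ?_
      rcases hQ with hQ | ⟨hQ, hs⟩
      · exact ihn _ hQ _ Q rfl rfl
      · rcases (Set.ncard_le_ncard hQ (finite_eqsVars P)).lt_or_eq with h | h
        · exact ihn _ h _ Q rfl rfl
        · exact ihm _ hs Q h rfl

/-- Unifiable terms have a most general unifier. -/
theorem exists_isMGU {s t : L.Term V} {τ : V → L.Term V} (h : s.subst τ = t.subst τ) :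
    ∃ σ, IsMGU σ s t := by
  have hiff : ∀ τ : V → L.Term V, Solves τ [(s, t)] ↔ s.subst τ = t.subst τ := by simp [Solves]
  obtain ⟨σ, hσ, hs, hm⟩ := hasPrincipalSolution [(s, t)] ⟨τ, (hiff τ).2 h⟩
  exact ⟨σ, ⟨hσ, (hiff σ).1 hs⟩, fun τ hτ => ⟨τ, hτ.1, hm τ ((hiff τ).2 hτ.2)⟩⟩

/-- A finite set of variables can be renamed apart from another one. -/
theorem exists_renaming_avoiding [Infinite V] {A F : Set V} (hA : A.Finite) (hF : F.Finite) :
    ∃ π : Equiv.Perm V, IsRenaming π ∧ ∀ x ∈ A, π x ∉ F := by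
  classical
  induction A, hA using Set.Finite.induction_on with
  | empty => exact ⟨1, by simp [IsRenaming], by simp⟩
  | @insert a A ha hA ih =>
    obtain ⟨π, hπ, hdisj⟩ := ih
    obtain ⟨y, hy⟩ := ((hF.union (hA.image π)).insert (π a)).exists_notMem
    simp only [Set.mem_insert_iff, Set.mem_union, Set.mem_image, not_or, not_exists, not_and] at hy
    obtain ⟨-, hyF, hyA⟩ := hy
    refine ⟨Equiv.swap (π a) y * π, ?_, ?_⟩
    · refine ((Set.toFinite {π a, y}).union hπ).subset fun x hx => ?_
      by_contra h
      simp only [Set.mem_union, Set.mem_insert_iff, Set.mem_singleton_iff, Set.mem_ofPred_eq,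
        not_or, not_not] at h
      exact hx (by rw [Equiv.Perm.mul_apply, h.2, Equiv.swap_apply_of_ne_of_ne h.1.1 h.1.2])
    · rintro x (rfl | hx)
      · simpa using hyF
      · have h1 : π x ≠ π a := fun h => ha (π.injective h ▸ hx)
        rw [Equiv.Perm.mul_apply, Equiv.swap_apply_of_ne_of_ne h1 (hyA x hx)]
        exact hdisj x hx

end Unification

/-! ### Variable overlaps and critical overlaps -/

section Overlaps

variable {L : FirstOrder.Language.{u, v}} {V : Type w}

/-- In a variable overlap, the step inside the substitution can be repeated at all other occurrences
of the variable. -/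
theorem reflTransGen_replaceAt_subst {r : L.Term V → L.Term V → Prop} (hr : ClosedContext r)
    {t : L.Term V} {o : List ℕ} {x : V} (ho : subtermAt t o = some (.var x))
    {σ σ' : V → L.Term V} (h : ∀ y, Relation.ReflTransGen r (σ y) (σ' y)) :
    Relation.ReflTransGen r (replaceAt (t.subst σ) o (σ' x)) (t.subst σ') := by
  induction ho using subtermAt_induction with
  | root => simpa using Relation.ReflTransGen.refl
  | arg f ts i p _ ih =>
    simp only [Term.subst, replaceAt_func_cons]
    refine reflTransGen_func hr f fun j => ?_
    by_cases hj : j = i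
    · subst hj; simpa using ih
    · simpa [hj] using reflTransGen_subst hr (ts j) h

theorem replaceAt_subst_of_isLinear {t : L.Term V} (ht : IsLinear t) {o : List ℕ} {x : V}
    (ho : subtermAt t o = some (.var x)) {σ σ' : V → L.Term V} (h : ∀ y ≠ x, σ y = σ' y) :
    replaceAt (t.subst σ) o (σ' x) = t.subst σ' := by
  induction ho using subtermAt_induction with
  | root => simp [Term.subst]
  | arg f ts i p hp ih =>
    simp only [Term.subst, replaceAt_func_cons, Term.func.injEq, heq_eq_eq, true_and]
    funext j
    by_cases hj : j = i
    · subst hj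
      have : IsLinear (ts j) := fun p q y hp hq => by
        simpa using ht (j :: p) (j :: q) y (subtermAt_func_cons.2 ⟨j.2, hp⟩)
          (subtermAt_func_cons.2 ⟨j.2, hq⟩)
      simpa using ih this
    · rw [Function.update_of_ne hj]
      refine subst_congr fun y hy => h y ?_
      rintro rfl
      obtain ⟨q, hq⟩ := exists_position_of_mem_vars hy
      have := ht (j :: q) (i :: p) y (subtermAt_func_cons.2 ⟨j.2, hq⟩)
        (subtermAt_func_cons.2 ⟨i.2, hp⟩)
      simp only [List.cons.injEq, Fin.val_inj] at this
      exact hj this.1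

theorem IsVariant.trans {e₁ e₂ e₃ : L.Term V × L.Term V} (h : IsVariant e₁ e₂)
    (h' : IsVariant e₂ e₃) : IsVariant e₁ e₃ := by
  obtain ⟨π, hπ, h₁, h₂⟩ := h
  obtain ⟨π', hπ', h₁', h₂'⟩ := h'
  refine ⟨π' * π, (Set.Finite.union hπ hπ').subset fun x hx => ?_, ?_, ?_⟩
  · by_contra h
    simp only [Set.mem_union, Set.mem_ofPred_eq, not_or, not_not] at h
    exact hx (by rw [Equiv.Perm.mul_apply, h.1, h.2])
  · rw [← h₁', ← h₁, subst_subst]; rfl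
  · rw [← h₂', ← h₂, subst_subst]; rfl

theorem IsVariant.refl (e : L.Term V × L.Term V) : IsVariant e e :=
  ⟨1, by simp [IsRenaming], by simp, by simp⟩

theorem IsVariant.symm {e₁ e₂ : L.Term V × L.Term V} (h : IsVariant e₁ e₂) : IsVariant e₂ e₁ := by
  obtain ⟨π, hπ, h₁, h₂⟩ := h
  refine ⟨π⁻¹, hπ.subset fun x hx h => hx ?_, ?_, ?_⟩
  · rw [Equiv.Perm.inv_eq_iff_eq, h]
  · rw [← h₁, subst_subst]; simp [Term.subst]
  · rw [← h₂, subst_subst]; simp [Term.subst]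

/-- The critical pair lemma for a single overlap: two overlapping steps are steps with variants of
the same rule at the same position or an instance of a critical peak. -/
theorem exists_criticalPeak [Infinite V] {X Y : System L V} {l₁ r₁ l₂ r₂ v : L.Term V}
    (h₁ : (l₁, r₁) ∈ X) (h₂ : (l₂, r₂) ∈ Y) {p : List ℕ} (hv : subtermAt l₂ p = some v)
    (hnv : ¬ IsVar v) {σ τ : V → L.Term V} (heq : v.subst σ = l₁.subst τ)
    (hvar : p = [] → ¬ IsVariant (l₁, r₁) (l₂, r₂)) :
    ∃ t s u ρ, CriticalPeak X Y t p s u ∧ IsSubst ρ ∧ s.subst ρ = l₂.subst σ ∧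
      t.subst ρ = replaceAt (l₂.subst σ) p (r₁.subst τ) ∧ u.subst ρ = r₂.subst σ := by
  classical
  set A := vars l₁ ∪ vars r₁ with hA
  set F := vars l₂ ∪ vars r₂ with hF
  have hAf : A.Finite := (finite_vars _).union (finite_vars _)
  have hFf : F.Finite := (finite_vars _).union (finite_vars _)
  obtain ⟨π, hπ, hdisj⟩ := exists_renaming_avoiding hAf hFf
  let ren : V → L.Term V := fun x => .var (π x)
  -- After renaming the first rule apart, both substitutions are merged into one.
  let θ : V → L.Term V :=
    restrictSubst (F ∪ π '' A) fun x => if x ∈ F then σ x else τ (π.symm x)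
  have hθ : IsSubst θ := isSubst_restrictSubst (hFf.union (hAf.image π)) _
  have hθF : ∀ {t : L.Term V}, vars t ⊆ F → t.subst θ = t.subst σ := fun {t} ht =>
    subst_congr fun x hx => by simp [θ, restrictSubst, ht hx]
  have hθA : ∀ {t : L.Term V}, vars t ⊆ A → (t.subst ren).subst θ = t.subst τ := by
    intro t ht
    rw [subst_subst]
    refine subst_congr fun x hx => ?_
    have hx' : π x ∈ F ∪ π '' A := .inr ⟨x, ht hx, rfl⟩
    simp only [ren, Term.subst, θ, restrictSubst, if_pos hx', if_neg (hdisj x (ht hx)),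
      Equiv.symm_apply_apply]
  have hvF : vars v ⊆ F := fun x hx => .inl (mem_vars_of_subtermAt hv hx)
  have hl₁ : vars l₁ ⊆ A := Set.subset_union_left
  have hr₁ : vars r₁ ⊆ A := Set.subset_union_right
  have hl₂ : vars l₂ ⊆ F := Set.subset_union_left
  have hr₂ : vars r₂ ⊆ F := Set.subset_union_right
  have hunif : (l₁.subst ren).subst θ = v.subst θ := by rw [hθA hl₁, hθF hvF, heq]
  obtain ⟨μ, hμ⟩ := exists_isMGU hunif
  obtain ⟨ρ, hρ, hμρ⟩ := hμ.2 θ ⟨hθ, hunif⟩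
  have hinst : ∀ t : L.Term V, (t.subst μ).subst ρ = t.subst θ := fun t => by
    rw [subst_subst]; exact subst_congr fun x _ => hμρ x
  have hren : IsVariant (l₁, r₁) (l₁.subst ren, r₁.subst ren) := ⟨π, hπ, rfl, rfl⟩
  have hvars : ∀ t : L.Term V, vars t ⊆ A → ∀ x ∈ vars (t.subst ren), x ∉ F := by
    intro t ht x hx
    obtain ⟨y, hy, hx⟩ := mem_vars_subst.1 hx
    obtain rfl := mem_vars_var.1 hx
    exact hdisj y (ht hy)
  refine ⟨_, _, _, ρ, ⟨(l₁.subst ren, r₁.subst ren), (l₂, r₂), v, μ, ⟨⟨_, h₁, hren⟩,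
    ⟨_, h₂, .refl _⟩, ?_, ⟨v, hv, hnv⟩, ⟨v, θ, hv, hθ, hunif⟩,
    fun hp h => hvar hp (hren.trans h)⟩, hv, hμ, rfl, rfl, rfl⟩, hρ, ?_, ?_, ?_⟩
  · rw [Set.disjoint_left]
    rintro x (hx | hx)
    exacts [hvars _ hl₁ x hx, hvars _ hr₁ x hx]
  · rw [hinst, hθF hl₂]
  · rw [replaceAt_subst (subtermAt_subst hv μ), hinst, hinst, hθF hl₂, hθA hr₁]
  · rw [hinst, hθF hr₂]

end Overlaps

/-! ### Prime critical pairs -/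

section Prime

variable {L : FirstOrder.Language.{u, v}} {V : Type w} {R B X Y : System L V}

theorem termSize_le_of_subtermAt {t u : L.Term V} {p : List ℕ} (h : subtermAt t p = some u) :
    termSize u ≤ termSize t := by
  induction h using subtermAt_induction with
  | root => rfl
  | arg f ts i p h ih =>
    have := Finset.single_le_sum (f := fun i => termSize (ts i))
      (fun _ _ => Nat.zero_le _) (Finset.mem_univ i)
    simp only [termSize]
    omega

theorem termSize_lt_of_subtermAt {t u : L.Term V} {p : List ℕ} (h : subtermAt t p = some u)
    (hp : p ≠ []) : termSize u < termSize t := by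
  induction h using subtermAt_induction with
  | root => exact absurd rfl hp
  | arg f ts i p h ih =>
    have := Finset.single_le_sum (f := fun i => termSize (ts i))
      (fun _ _ => Nat.zero_le _) (Finset.mem_univ i)
    have := termSize_le_of_subtermAt h
    simp only [termSize]
    omega

theorem primeAt_append {s v : L.Term V} {p : List ℕ} (h : subtermAt s p = some v) (q : List ℕ) :
    PrimeAt R s (p ++ q) ↔ PrimeAt R v q := by
  simp only [PrimeAt, subtermAt_append h]

theorem PrimeAt.of_subst {s : L.Term V} {ρ : V → L.Term V} (hρ : IsSubst ρ) {p : List ℕ}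
    (h : PrimeAt R (s.subst ρ) p) : PrimeAt R s p := fun _ q _ hv hq hv' _ hw =>
  h _ q _ (subtermAt_subst hv ρ) hq (subtermAt_subst hv' ρ) _ (closedSubst_rew ρ _ _ hρ hw)

/-- Every reducible term has an innermost redex. -/
theorem exists_innermost_redex {s s' : L.Term V} (h : Rew R s s') :
    ∃ q l r τ, (l, r) ∈ R ∧ subtermAt s q = some (l.subst τ) ∧ PrimeAt R s q := by
  induction hn : termSize s using Nat.strong_induction_on generalizing s s' with
  | _ n ih =>
    obtain ⟨l, r, p, σ, hlr, -, hp, -⟩ := h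
    by_cases hprime : PrimeAt R s p
    · exact ⟨p, l, r, σ, hlr, hp, hprime⟩
    · simp only [PrimeAt, IsNF, not_forall, not_not] at hprime
      obtain ⟨v, q, v', hv, hq, hv', w, hw⟩ := hprime
      obtain ⟨q', l', r', τ, hlr', hq', hprime'⟩ := ih (termSize v') (hn ▸
        (termSize_lt_of_subtermAt hv' hq).trans_le (termSize_le_of_subtermAt hv)) hw rfl
      have hpq : subtermAt s (p ++ q) = some v' := by rw [subtermAt_append hv, hv']
      refine ⟨(p ++ q) ++ q', l', r', τ, hlr', ?_, ?_⟩
      · rw [subtermAt_append hpq, hq']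
      · rwa [primeAt_append hpq]

/-- `Res` is a relation that joins the prime critical pairs: it is symmetric, closed under contexts
and substitutions, and contains the valleys and the prime critical pairs. -/
structure Resolves (R B : System L V) (Res : L.Term V → L.Term V → Prop) : Prop where
  context : ClosedContext Res
  subst : ClosedSubst Res
  symm : ∀ s t, Res s t → Res t s
  valley : ∀ s t, Valley R B s t → Res s t
  pcp : ∀ e ∈ PCP R ∪ PCPpm R B, Res e.1 e.2

/-- The pairs of systems whose overlaps are considered: `R` with `R`, and `R` with `B^±` in both
directions. -/
def Overlapping (R B X Y : System L V) : Prop :=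
  (X = R ∧ Y = R) ∨ (X = R ∧ Y = pm B) ∨ (X = pm B ∧ Y = R)

/-- No rule of `R` is a variant of an equation in `B^±`. -/
def NoVariants (R B : System L V) : Prop := ∀ e ∈ R, ∀ e' ∈ pm B, ¬ IsVariant e e'

/-- A variable overlap is joinable.  Left-linearity is needed for steps with `B^±` below a step with
`R`, since these need not be repeated at other occurrences of the variable. -/
theorem valley_of_variable_overlap (hlin : LeftLinear R) (hXY : Overlapping R B X Y)
    {l₁ r₁ l₂ r₂ : L.Term V} (h₁ : (l₁, r₁) ∈ X) (h₂ : (l₂, r₂) ∈ Y) {o q : List ℕ} {x : V}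
    (ho : subtermAt l₂ o = some (.var x)) {σ τ : V → L.Term V}
    (hq : subtermAt (σ x) q = some (l₁.subst τ)) :
    Valley R B (replaceAt (l₂.subst σ) (o ++ q) (r₁.subst τ)) (r₂.subst σ) := by
  classical
  set σ' : V → L.Term V := Function.update σ x (replaceAt (σ x) q (r₁.subst τ)) with hσ'
  have ht : replaceAt (l₂.subst σ) (o ++ q) (r₁.subst τ) = replaceAt (l₂.subst σ) o (σ' x) := by
    rw [replaceAt_append (subtermAt_subst ho σ)]; simp [hσ', Term.subst]
  have hstep : ∀ y, Relation.ReflTransGen (Rew X) (σ y) (σ' y) := by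
    intro y
    by_cases hy : y = x
    · subst hy; simpa [hσ'] using .single (Rew.of_subterm h₁ hq)
    · simpa [hσ', hy] using Relation.ReflTransGen.refl
  have hroot : Rew Y (l₂.subst σ') (r₂.subst σ') := .of_subst h₂ σ'
  rw [ht]
  rcases hXY with ⟨rfl, rfl⟩ | ⟨rfl, rfl⟩ | ⟨rfl, rfl⟩
  · exact ⟨_, _, (reflTransGen_replaceAt_subst closedContext_rew ho hstep).tail hroot, .refl,
      reflTransGen_subst closedContext_rew r₂ hstep⟩
  · exact ⟨_, _, reflTransGen_replaceAt_subst closedContext_rew ho hstep, .of_rew_pm hroot,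
      reflTransGen_subst closedContext_rew r₂ hstep⟩
  · rw [replaceAt_subst_of_isLinear (hlin _ h₂) ho
      (fun y hy => by simp [hσ', hy])]
    refine ⟨_, _, .single hroot, Sim.symm ?_, .refl⟩
    exact (reflTransGen_subst closedContext_rew r₂ hstep).lift id fun _ _ => rew_pm.1

variable {Res : L.Term V → L.Term V → Prop}

theorem Resolves.refl (hRes : Resolves R B Res) (s : L.Term V) : Res s s :=
  hRes.valley _ _ (.refl s)

theorem Resolves.prime_peak [Infinite V] (hRes : Resolves R B Res) (hR : IsTRS R)
    (hlin : LeftLinear R) (hvar : NoVariants R B) (hXY : Overlapping R B X Y)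
    {l₁ r₁ l₂ r₂ : L.Term V} (h₁ : (l₁, r₁) ∈ X) (h₂ : (l₂, r₂) ∈ Y) {p : List ℕ}
    {σ τ : V → L.Term V} (hp : subtermAt (l₂.subst σ) p = some (l₁.subst τ))
    (hprime : PrimeAt R (l₂.subst σ) p) :
    Res (replaceAt (l₂.subst σ) p (r₁.subst τ)) (r₂.subst σ) := by
  obtain ⟨v, hv, hnv, heq⟩ | ⟨o, q, x, rfl, ho, hq⟩ := position_subst hp
  · by_cases hroot : p = [] ∧ IsVariant (l₁, r₁) (l₂, r₂)
    · obtain ⟨rfl, hroot⟩ := hroot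
      rcases hXY with ⟨rfl, rfl⟩ | ⟨rfl, rfl⟩ | ⟨rfl, rfl⟩
      · -- Variants of one rule applied at the same position yield the same term.
        obtain ⟨π, -, rfl, rfl⟩ := hroot
        have heq : l₁.subst τ = l₁.subst fun x => σ (π x) := by
          simpa [subst_subst, Term.subst] using hp.symm
        have : (r₁.subst fun x => Term.var (π x)).subst σ = r₁.subst τ := by
          rw [subst_subst]
          exact subst_congr fun x hx => (eq_of_subst_eq heq ((hR _ h₁).2 hx)).symm
        simpa [this] using hRes.refl _
      · exact absurd hroot (hvar _ h₁ _ h₂)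
      · exact absurd hroot.symm (hvar _ h₂ _ h₁)
    · obtain ⟨t, s, u, ρ, hpeak, hρ, hs, ht, hu⟩ :=
        exists_criticalPeak h₁ h₂ hv hnv heq.symm (not_and.1 hroot)
      rw [← ht, ← hu]
      refine hRes.subst ρ t u hρ (hRes.pcp (t, u) ?_)
      have hprime : PrimeAt R s p := .of_subst hρ (hs ▸ hprime)
      rcases hXY with ⟨rfl, rfl⟩ | ⟨rfl, rfl⟩ | ⟨rfl, rfl⟩
      · exact .inl ⟨p, s, hpeak, hprime⟩
      · exact .inr ⟨p, s, .inl hpeak, hprime⟩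
      · exact .inr ⟨p, s, .inr hpeak, hprime⟩
  · exact hRes.valley _ _ (valley_of_variable_overlap hlin hXY h₁ h₂ ho hq)

/-- A peak that need not be prime is split at the reduct of an innermost redex below the inner
step: the two resulting peaks are prime. -/
theorem Resolves.root_peak [Infinite V] (hRes : Resolves R B Res) (hR : IsTRS R)
    (hlin : LeftLinear R) (hvar : NoVariants R B) (hXY : Overlapping R B X Y)
    {l₁ r₁ l₂ r₂ : L.Term V} (h₁ : (l₁, r₁) ∈ X) (h₂ : (l₂, r₂) ∈ Y) {p : List ℕ}
    {σ τ : V → L.Term V} (hp : subtermAt (l₂.subst σ) p = some (l₁.subst τ)) :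
    ∃ v, Rew R (l₂.subst σ) v ∧ Res (replaceAt (l₂.subst σ) p (r₁.subst τ)) v ∧
      Res v (r₂.subst σ) := by
  by_cases hprime : PrimeAt R (l₂.subst σ) p
  · have h := hRes.prime_peak hR hlin hvar hXY h₁ h₂ hp hprime
    have hstep₁ := Rew.of_subterm h₁ hp
    have hstep₂ := Rew.of_subst h₂ σ
    rcases hXY with ⟨rfl, rfl⟩ | ⟨rfl, rfl⟩ | ⟨rfl, rfl⟩
    · exact ⟨_, hstep₁, hRes.refl _, h⟩
    · exact ⟨_, hstep₁, hRes.refl _, h⟩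
    · exact ⟨_, hstep₂, h, hRes.refl _⟩
  · simp only [PrimeAt, IsNF, not_forall, not_not] at hprime
    obtain ⟨v, q, v', hv, hq, hv', w, hw⟩ := hprime
    obtain rfl : v = l₁.subst τ := by simpa [hp] using hv.symm
    obtain ⟨q', l, r, τ', hlr, hq', hprime⟩ := exists_innermost_redex hw
    have hredex : subtermAt (l₁.subst τ) (q ++ q') = some (l.subst τ') := by
      rw [subtermAt_append hv', hq']
    have hredex' : subtermAt (l₂.subst σ) (p ++ (q ++ q')) = some (l.subst τ') := by
      rw [subtermAt_append hp, hredex]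
    have hprime₁ : PrimeAt R (l₁.subst τ) (q ++ q') := (primeAt_append hv' q').2 hprime
    have hprime₂ : PrimeAt R (l₂.subst σ) (p ++ (q ++ q')) := (primeAt_append hp _).2 hprime₁
    have hRX : Overlapping R B R X := by
      rcases hXY with ⟨rfl, rfl⟩ | ⟨rfl, rfl⟩ | ⟨rfl, rfl⟩ <;> simp [Overlapping]
    have hRY : Overlapping R B R Y := by
      rcases hXY with ⟨rfl, rfl⟩ | ⟨rfl, rfl⟩ | ⟨rfl, rfl⟩ <;> simp [Overlapping]
    refine ⟨_, .of_subterm hlr hredex', ?_,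
      hRes.prime_peak hR hlin hvar hRY hlr h₂ hredex' hprime₂⟩
    rw [replaceAt_append hp]
    exact hRes.context _ _ _ _ ⟨_, hp⟩
      (hRes.symm _ _ (hRes.prime_peak hR hlin hvar hRX hlr h₁ hredex hprime₁))

/-- Local peaks and local cliffs are resolved by two `Res`-steps through a common reduct. -/
theorem Resolves.local_peak [Infinite V] (hRes : Resolves R B Res) (hR : IsTRS R)
    (hlin : LeftLinear R) (hvar : NoVariants R B) (hY : Y = R ∨ Y = pm B) {s t u : L.Term V}
    (ht : Rew R s t) (hu : Rew Y s u) : ∃ v, Rew R s v ∧ Res t v ∧ Res v u := by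
  obtain ⟨l₁, r₁, p, τ, h₁, -, hp, rfl⟩ := ht
  obtain ⟨l₂, r₂, q, σ, h₂, -, hq, rfl⟩ := hu
  have hRY : Overlapping R B R Y := by rcases hY with rfl | rfl <;> simp [Overlapping]
  have hYR : Overlapping R B Y R := by rcases hY with rfl | rfl <;> simp [Overlapping]
  induction p generalizing s q with
  | nil =>
    obtain rfl : s = l₁.subst τ := by simpa using hp
    obtain ⟨v, hv, huv, hvt⟩ := hRes.root_peak hR hlin hvar hYR h₂ h₁ hq
    exact ⟨v, hv, by simpa using hRes.symm _ _ hvt, hRes.symm _ _ huv⟩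
  | cons i p ih =>
    cases q with
    | nil =>
      obtain rfl : s = l₂.subst σ := by simpa using hq
      simpa using hRes.root_peak hR hlin hvar hRY h₁ h₂ hp
    | cons j q =>
      cases s with
      | var x => simp at hp
      | func f ts =>
        obtain ⟨hi, hp⟩ := subtermAt_func_cons.1 hp
        obtain ⟨hj, hq⟩ := subtermAt_func_cons.1 hq
        by_cases hij : i = j
        · subst hij
          have hpos : subtermAt (.func f ts) [i] = some (ts ⟨i, hi⟩) :=
            subtermAt_func_cons.2 ⟨hi, by simp⟩
          obtain ⟨v, hv, htv, hvu⟩ := ih hp q hq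
          refine ⟨replaceAt (.func f ts) [i] v, ?_, ?_, ?_⟩
          · simpa only [replaceAt_self hpos] using closedContext_rew _ _ _ _ ⟨_, hpos⟩ hv
          · exact replaceAt_append hpos p _ ▸ hRes.context _ _ _ _ ⟨_, hpos⟩ htv
          · exact replaceAt_append hpos q _ ▸ hRes.context _ _ _ _ ⟨_, hpos⟩ hvu
        · -- Steps in different arguments commute.
          lift i to Fin _ using hi
          lift j to Fin _ using hj
          have hij : i ≠ j := fun h => hij (h ▸ rfl)
          have hp' : subtermAt (.func f ts) (i :: p) = some (l₁.subst τ) :=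
            subtermAt_func_cons.2 ⟨i.2, hp⟩
          refine ⟨_, .of_subterm h₁ hp', hRes.refl _, hRes.valley _ _ ?_⟩
          simp only [replaceAt_func_cons]
          set a := replaceAt (ts i) p (r₁.subst τ) with ha
          set b := replaceAt (ts j) q (r₂.subst σ) with hb
          have hl : Rew Y (.func f (Function.update ts i a))
              (.func f (Function.update (Function.update ts i a) j b)) := by
            have hpos : subtermAt (.func f (Function.update ts i a)) (j :: q) =
                some (l₂.subst σ) := subtermAt_func_cons.2 ⟨j.2, by simpa [hij.symm] using hq⟩
            simpa [replaceAt_func_cons, hij.symm] using Rew.of_subterm h₂ hpos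
          have hr : Rew R (.func f (Function.update ts j b))
              (.func f (Function.update (Function.update ts i a) j b)) := by
            have hpos : subtermAt (.func f (Function.update ts j b)) (i :: p) =
                some (l₁.subst τ) := subtermAt_func_cons.2 ⟨i.2, by simpa [hij] using hp⟩
            rw [Function.update_comm hij]
            simpa [replaceAt_func_cons, hij] using Rew.of_subterm h₁ hpos
          rcases hY with rfl | rfl
          · exact ⟨_, _, .single hl, .refl, .single hr⟩
          · exact ⟨_, _, .refl, .of_rew_pm hl, .single hr⟩

end Prime

/-! ### Compatible reduction orders -/

section Order

variable {L : FirstOrder.Language.{u, v}} {V : Type w} {R B : System L V}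
  {gt : L.Term V → L.Term V → Prop}

namespace IsCompatibleReductionOrder

variable (hgt : IsCompatibleReductionOrder B gt)
include hgt

theorem of_sim_left {s s' t : L.Term V} (h : Sim B s s') (h' : gt s' t) : gt s t :=
  hgt.compatible _ _ _ _ h h' .refl

theorem of_sim_right {s t t' : L.Term V} (h : gt s t) (h' : Sim B t t') : gt s t' :=
  hgt.compatible _ _ _ _ .refl h h'

theorem not_chain (f : ℕ → L.Term V) : ¬ ∀ n, gt (f n) (f (n + 1)) := by
  intro h
  obtain ⟨_, ⟨n, rfl⟩, hmin⟩ := hgt.wf.has_min (Set.range f) ⟨_, 0, rfl⟩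
  exact hmin _ ⟨n + 1, rfl⟩ (h n)

theorem irrefl (s : L.Term V) : ¬ gt s s := fun h => hgt.not_chain (fun _ => s) fun _ => h

theorem not_sim {s t : L.Term V} (h : gt s t) : ¬ Sim B s t := fun h' =>
  hgt.irrefl s (hgt.of_sim_right h h'.symm)

theorem asymm {s t : L.Term V} (h : gt s t) : ¬ gt t s := fun h' =>
  hgt.irrefl s (hgt.trans _ _ _ h h')

/-- A term is not greater than one that contains an instance of it: otherwise nesting the context
would give an infinite descending chain. -/
theorem not_subterm_subst {s t : L.Term V} {σ : V → L.Term V} {p : List ℕ} (h : gt s t)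
    (hσ : IsSubst σ) (hp : subtermAt t p = some (s.subst σ)) : False := by
  let f : ℕ → L.Term V := fun n => (fun u => replaceAt t p (u.subst σ))^[n] s
  have hsucc : ∀ n, f (n + 1) = replaceAt t p ((f n).subst σ) := fun n =>
    Function.iterate_succ_apply' _ n s
  refine hgt.not_chain f fun n => ?_
  induction n with
  | zero => simpa [hsucc, f, replaceAt_self hp] using h
  | succ n ih =>
    rw [hsucc n, hsucc (n + 1)]
    exact hgt.closed_context _ _ _ _ ⟨_, hp⟩ (hgt.closed_subst σ _ _ hσ ih)

/-- If `t` had a variable that `s` lacks, then substituting `s` for it would embed `s` into a smaller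
term. -/
theorem vars_subset {s t : L.Term V} (h : gt s t) : vars t ⊆ vars s := by
  classical
  intro x hx
  by_contra hxs
  obtain ⟨p, hp⟩ := exists_position_of_mem_vars hx
  have hs : s.subst (Function.update .var x s) = s := by
    conv_rhs => rw [← subst_var s]
    exact subst_congr fun y hy => Function.update_of_ne (ne_of_mem_of_not_mem hy hxs) _ _
  have h' := hgt.closed_subst _ _ _ (isSubst_update x s) h
  have hp' := subtermAt_subst hp (Function.update .var x s)
  rw [hs] at h'
  exact hgt.not_subterm_subst h' isSubst_var (by simpa [Term.subst] using hp')

/-- A variable `x` is not greater than any term `t`: if `x` occurs in `t`, then `t` contains `x`, and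
otherwise substituting `t` for `x` gives `t > t`. -/
theorem not_isVar {s t : L.Term V} (h : gt s t) : ¬ IsVar s := by
  classical
  rintro ⟨x, rfl⟩
  by_cases hx : x ∈ vars t
  · obtain ⟨p, hp⟩ := exists_position_of_mem_vars hx
    exact hgt.not_subterm_subst h isSubst_var (by simpa using hp)
  · have ht : t.subst (Function.update .var x t) = t := by
      conv_rhs => rw [← subst_var t]
      exact subst_congr fun y hy => Function.update_of_ne (ne_of_mem_of_not_mem hy hx) _ _
    have h' := hgt.closed_subst _ _ _ (isSubst_update x t) h
    rw [ht] at h'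
    exact hgt.irrefl t (by simpa [Term.subst] using h')

theorem of_rew (hR : ∀ s t, (s, t) ∈ R → gt s t) {s t : L.Term V} (h : Rew R s t) : gt s t :=
  h.rel hgt.closed_context hgt.closed_subst hR

theorem isTRS (hR : ∀ s t, (s, t) ∈ R → gt s t) : IsTRS R := fun _ he =>
  ⟨hgt.not_isVar (hR _ _ he), hgt.vars_subset (hR _ _ he)⟩

theorem noVariants (hR : ∀ s t, (s, t) ∈ R → gt s t) : NoVariants R B := by
  rintro ⟨l, r⟩ he ⟨l', r'⟩ he' ⟨π, hπ, rfl, rfl⟩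
  have hsub : IsSubst fun x => (.var (π x) : L.Term V) := hπ.subset fun x hx h => hx (congrArg _ h)
  exact hgt.not_sim (hgt.closed_subst _ _ _ hsub (hR _ _ he)) (.of_rew_pm (.of_mem he'))

theorem terminatingModulo (hR : ∀ s t, (s, t) ∈ R → gt s t) : TerminatingModulo R B := by
  rintro ⟨f, hf⟩
  refine hgt.not_chain f fun n => ?_
  obtain ⟨b, ⟨a, h₁, h₂⟩, h₃⟩ := hf n
  exact hgt.compatible _ _ _ _ h₁ (hgt.of_rew hR h₂) h₃

end IsCompatibleReductionOrder

end Order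

/-! ### Conversions below a bound -/

section Conversions

variable {L : FirstOrder.Language.{u, v}} {V : Type w} {R B : System L V}
  {gt : L.Term V → L.Term V → Prop} {K K' : L.Term V → Prop}

/-- Conversions modulo `B` in which all terms satisfy `K`; empty conversions are always admitted. -/
def ConvOn (R B : System L V) (K : L.Term V → Prop) : L.Term V → L.Term V → Prop :=
  Relation.ReflTransGen fun s t => K s ∧ K t ∧ (Rew R t s ∨ Rew R s t ∨ Sim B s t)

theorem ConvOn.lift {s t : L.Term V} (h : ConvOn R B K s t) (f : L.Term V → L.Term V)
    (hR : ∀ s t, Rew R s t → Rew R (f s) (f t)) (hB : ∀ s t, Sim B s t → Sim B (f s) (f t))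
    (hK : ∀ x, K x → K' (f x)) : ConvOn R B K' (f s) (f t) :=
  Relation.ReflTransGen.lift f (fun _ _ h => ⟨hK _ h.1, hK _ h.2.1,
    h.2.2.imp (hR _ _) (Or.imp (hR _ _) (hB _ _))⟩) _ _ h

theorem ConvOn.mono {s t : L.Term V} (h : ConvOn R B K s t) (hK : ∀ x, K x → K' x) :
    ConvOn R B K' s t :=
  h.lift id (fun _ _ => id) (fun _ _ => id) hK

theorem ConvOn.trans {s t u : L.Term V} (h : ConvOn R B K s t) (h' : ConvOn R B K t u) :
    ConvOn R B K s u := Relation.ReflTransGen.trans h h'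

theorem ConvOn.symm {s t : L.Term V} (h : ConvOn R B K s t) : ConvOn R B K t s := by
  have : Std.Symm fun s t : L.Term V => K s ∧ K t ∧ (Rew R t s ∨ Rew R s t ∨ Sim B s t) :=
    ⟨fun s t h => ⟨h.2.1, h.1, by
      rcases h.2.2 with h | h | h
      exacts [.inr (.inl h), .inl h, .inr (.inr h.symm)]⟩⟩
  exact symm_of (Relation.ReflTransGen _) h

theorem ConvOn.of_rew {s t : L.Term V} (h : Rew R s t) (hs : K s) (ht : K t) : ConvOn R B K s t :=
  .single ⟨hs, ht, .inr (.inl h)⟩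

theorem ConvOn.of_sim {s t : L.Term V} (h : Sim B s t) (hs : K s) (ht : K t) : ConvOn R B K s t :=
  .single ⟨hs, ht, .inr (.inr h)⟩

/-- A set of terms that is closed under taking smaller terms. -/
def DownClosed (gt : L.Term V → L.Term V → Prop) (K : L.Term V → Prop) : Prop :=
  ∀ s t, K s → gt s t → K t

theorem ConvOn.of_reflTransGen (hR : ∀ s t, Rew R s t → gt s t) (hK : DownClosed gt K)
    {s t : L.Term V} (h : Relation.ReflTransGen (Rew R) s t) (hs : K s) :
    ConvOn R B K s t ∧ K t := by
  induction h with
  | refl => exact ⟨.refl, hs⟩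
  | tail _ h ih =>
    have := hK _ _ ih.2 (hR _ _ h)
    exact ⟨ih.1.trans (.of_rew h ih.2 this), this⟩

theorem Valley.head {s s' t : L.Term V} (h : Rew R s s') (h' : Valley R B s' t) :
    Valley R B s t := by
  obtain ⟨a, b, ha, hab, hb⟩ := h'
  exact ⟨a, b, ha.head h, hab, hb⟩

theorem Valley.tail {s t t' : L.Term V} (h' : Valley R B s t')
    (h : Relation.ReflTransGen (Rew R) t t') : Valley R B s t := by
  obtain ⟨a, b, ha, hab, hb⟩ := h'
  exact ⟨a, b, ha, hab, h.trans hb⟩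

/-- If peaks at terms satisfying `K` can be joined with valleys starting at the peak, then all
conversions through terms satisfying `K` have valleys. -/
theorem ConvOn.valley (hQ : ∀ s, K s → ∀ a c d, (Rew R s a ∨ Sim B s a) →
      Relation.ReflTransGen (Rew R) s c → Sim B c d → Valley R B a d)
    {s t : L.Term V} (h : ConvOn R B K s t) : Valley R B s t := by
  induction h using Relation.ReflTransGen.head_induction_on with
  | refl => exact .refl _
  | head h _ ih =>
    obtain ⟨-, hK, h⟩ := h
    obtain ⟨c, d, hc, hcd, hd⟩ := ih
    rcases h with h | h | h
    · exact (hQ _ hK _ _ _ (.inl h) hc hcd).tail hd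
    · exact .head h ⟨c, d, hc, hcd, hd⟩
    · exact (hQ _ hK _ _ _ (.inr h.symm) hc hcd).tail hd

/-- An abstract criterion for the Church-Rosser property modulo `B`: every local peak has a
conversion below its source, and every local cliff `t ← s ↔ u` has one from `t` to a reduct of `u`
below its source. -/
theorem churchRosserModulo_of_local (hgt : IsCompatibleReductionOrder B gt)
    (hR : ∀ s t, Rew R s t → gt s t)
    (hpeak : ∀ s t u, Rew R s t → Rew R s u → ConvOn R B (gt s) t u)
    (hcliff : ∀ s t u, Rew R s t → SymRew B s u → ∃ u', Rew R u u' ∧ ConvOn R B (gt s) t u') :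
    ChurchRosserModulo R B := by
  -- Coherence for a single `B`-step propagates along the equivalence class.
  have hcoh : ∀ s t u, Rew R s t → Sim B s u →
      ∃ u', Rew R u u' ∧ ConvOn R B (gt s) t u' := by
    intro s t u hst hsu
    induction hsu with
    | refl => exact ⟨t, hst, .refl⟩
    | tail hsm hmu ih =>
      obtain ⟨m', hm, hconv⟩ := ih
      obtain ⟨u', hu, hconv'⟩ := hcliff _ _ _ hm hmu
      exact ⟨u', hu, hconv.trans (hconv'.mono fun x => hgt.of_sim_left hsm)⟩
  have hdown : ∀ s, DownClosed gt (gt s) := fun s x y => hgt.trans s x y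
  -- A longer valley starting at `s` continues below `s`, where the induction hypothesis applies.
  have hQ : ∀ s a c d, (Rew R s a ∨ Sim B s a) → Relation.ReflTransGen (Rew R) s c →
      Sim B c d → Valley R B a d := by
    intro s
    induction s using hgt.wf.induction with
    | _ s ih =>
      intro a c d hsa hsc hcd
      rcases hsc.cases_head with rfl | ⟨b, hsb, hbc⟩
      · rcases hsa with hsa | hsa
        · obtain ⟨d', hd, hconv⟩ := hcoh _ _ _ hsa hcd
          exact (hconv.valley ih).tail (.single hd)
        · exact ⟨a, d, .refl, hsa.symm.trans hcd, .refl⟩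
      · obtain ⟨hconv, hc⟩ := ConvOn.of_reflTransGen hR (hdown s) hbc (hR _ _ hsb)
        have hbd : ConvOn R B (gt s) b d :=
          hconv.trans (.of_sim hcd hc (hgt.of_sim_right hc hcd))
        rcases hsa with hsa | hsa
        · exact ((hpeak _ _ _ hsa hsb).trans hbd).valley ih
        · obtain ⟨a', ha, hconv⟩ := hcoh _ _ _ hsb hsa
          exact .head ha ((hconv.symm.trans hbd).valley ih)
  intro s t h
  have : ConvOn R B (fun _ => True) s t := h.lift id fun _ _ h => ⟨trivial, trivial, h⟩
  exact this.valley fun s _ => hQ s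

end Conversions

/-! ### Simulation of a run by its final system -/

section Simulation

variable {L : FirstOrder.Language.{u, v}} {V : Type w} {R B : System L V}
  {gt : L.Term V → L.Term V → Prop} {K : L.Term V → Prop} {s t u : L.Term V}

/-- The step `s → t` is simulated in `R` modulo `B`: some reduct of `s` is convertible to `t` below
`s`. -/
def SimulatedStep (gt : L.Term V → L.Term V → Prop) (R B : System L V) (s t : L.Term V) : Prop :=
  ∃ w, Rew R s w ∧ ConvOn R B (gt s) w t

/-- The equation `s ≈ t` is simulated in `R` modulo `B`: either `s ∼ t`, or there is a conversion
of `s` and `t` which starts with a rewrite step from `s` unless `t > s`, ends with a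
(reversed) rewrite step from `t` unless `s > t`, and otherwise uses only terms that are smaller
than `s` or `t`. -/
def SimulatedEq (gt : L.Term V → L.Term V → Prop) (R B : System L V) (s t : L.Term V) : Prop :=
  Sim B s t ∨ ∃ s' t', (Rew R s s' ∨ s' = s ∧ gt t s) ∧ (Rew R t t' ∨ t' = t ∧ gt s t) ∧
    ConvOn R B (fun x => gt s x ∨ gt t x) s' t'

theorem SimulatedEq.symm (h : SimulatedEq gt R B s t) : SimulatedEq gt R B t s := by
  rcases h with h | ⟨s', t', hs, ht, h⟩
  · exact .inl h.symm
  · exact .inr ⟨t', s', ht, hs, h.symm.mono fun _ => Or.symm⟩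

section

variable (hgt : IsCompatibleReductionOrder B gt)
include hgt

theorem closedContext_simulatedStep : ClosedContext (SimulatedStep gt R B) := by
  rintro c p s t hp ⟨w, hw, h⟩
  exact ⟨_, closedContext_rew c p _ _ hp hw, h.lift _ (fun _ _ => closedContext_rew c p _ _ hp)
    (fun _ _ => closedContext_sim c p _ _ hp) fun _ => hgt.closed_context c p _ _ hp⟩

theorem closedSubst_simulatedStep : ClosedSubst (SimulatedStep gt R B) := by
  rintro σ s t hσ ⟨w, hw, h⟩
  exact ⟨_, closedSubst_rew σ _ _ hσ hw, h.lift (fun x => x.subst σ)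
    (fun _ _ => closedSubst_rew σ _ _ hσ) (fun _ _ => closedSubst_sim σ _ _ hσ)
    fun _ => hgt.closed_subst σ _ _ hσ⟩

theorem closedContext_simulatedEq : ClosedContext (SimulatedEq gt R B) := by
  rintro c p s t hp (h | ⟨s', t', hs, ht, h⟩)
  · exact .inl (closedContext_sim c p _ _ hp h)
  · have hrew := fun s t => closedContext_rew (E := R) c p s t hp
    have hgt' := fun s t => hgt.closed_context c p s t hp
    exact .inr ⟨_, _, hs.imp (hrew _ _) (And.imp (congrArg _) (hgt' _ _)),
      ht.imp (hrew _ _) (And.imp (congrArg _) (hgt' _ _)),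
      h.lift _ hrew (fun _ _ => closedContext_sim c p _ _ hp) fun _ => Or.imp (hgt' _ _) (hgt' _ _)⟩

theorem closedSubst_simulatedEq : ClosedSubst (SimulatedEq gt R B) := by
  rintro σ s t hσ (h | ⟨s', t', hs, ht, h⟩)
  · exact .inl (closedSubst_sim σ _ _ hσ h)
  · have hrew := fun s t => closedSubst_rew (E := R) σ s t hσ
    have hgt' := fun s t => hgt.closed_subst σ s t hσ
    have hsub : ∀ s t : L.Term V, s = t → s.subst σ = t.subst σ := fun _ _ h => h ▸ rfl
    exact .inr ⟨_, _, hs.imp (hrew _ _) (And.imp (hsub _ _) (hgt' _ _)),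
      ht.imp (hrew _ _) (And.imp (hsub _ _) (hgt' _ _)),
      h.lift _ hrew (fun _ _ => closedSubst_sim σ _ _ hσ) fun _ => Or.imp (hgt' _ _) (hgt' _ _)⟩

end

theorem SimulatedStep.convOn (hR : ∀ s t, Rew R s t → gt s t) (h : SimulatedStep gt R B s t)
    (hK : DownClosed gt K) (hs : K s) : ConvOn R B K s t := by
  obtain ⟨w, hw, h⟩ := h
  exact (ConvOn.of_rew hw hs (hK _ _ hs (hR _ _ hw))).trans (h.mono fun x => hK _ _ hs)

theorem SimulatedStep.simulatedEq (h : SimulatedStep gt R B s t) (hst : gt s t) :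
    SimulatedEq gt R B s t := by
  obtain ⟨w, hw, h⟩ := h
  exact .inr ⟨w, t, .inl hw, .inr ⟨rfl, hst⟩, h.mono fun _ => .inl⟩

theorem SimulatedEq.convOn (hR : ∀ s t, Rew R s t → gt s t) (h : SimulatedEq gt R B s t)
    (hK : DownClosed gt K) (hs : K s) (ht : K t) : ConvOn R B K s t := by
  have hstep : ∀ a a', K a → ∀ P : Prop, Rew R a a' ∨ a' = a ∧ P → ConvOn R B K a a' := by
    rintro a a' ha P (h | ⟨rfl, -⟩)
    · exact .of_rew h ha (hK _ _ ha (hR _ _ h))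
    · exact .refl
  rcases h with h | ⟨s', t', hs', ht', h⟩
  · exact .of_sim h hs ht
  · refine (hstep _ _ hs _ hs').trans (.trans (h.mono ?_) (hstep _ _ ht _ ht').symm)
    rintro x (h | h)
    exacts [hK _ _ hs h, hK _ _ ht h]

section

variable (hgt : IsCompatibleReductionOrder B gt)
include hgt

/-- Simulation of an equation is preserved backwards by simplification of one side. -/
theorem SimulatedEq.simplify (hR : ∀ s t, Rew R s t → gt s t) (hsu : SimulatedStep gt R B s u)
    (h : gt s u) (hut : SimulatedEq gt R B u t) : SimulatedEq gt R B s t := by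
  obtain ⟨w, hw, hwu⟩ := hsu
  have hwu : ConvOn R B (fun x => gt s x ∨ gt t x) w u := hwu.mono fun _ => .inl
  rcases hut with hut | ⟨u', t', hu', ht', hut⟩
  · have hst := hgt.of_sim_right h hut
    exact .inr ⟨w, t, .inl hw, .inr ⟨rfl, hst⟩, hwu.trans (.of_sim hut (.inl h) (.inl hst))⟩
  · refine .inr ⟨w, t', .inl hw, ht'.imp id (And.imp id (hgt.trans _ _ _ h)), hwu.trans ?_⟩
    have huu' : ConvOn R B (fun x => gt s x ∨ gt t x) u u' := by
      rcases hu' with hu' | ⟨rfl, -⟩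
      · exact .of_rew hu' (.inl h) (.inl (hgt.trans _ _ _ h (hR _ _ hu')))
      · exact .refl
    exact huu'.trans (hut.mono fun x => Or.imp_left (hgt.trans _ _ _ h))

theorem Valley.simulatedEq (hR : ∀ s t, Rew R s t → gt s t) (h : Valley R B s t) :
    SimulatedEq gt R B s t := by
  have hdown : DownClosed gt fun x => gt s x ∨ gt t x := fun x y h hxy =>
    h.imp (fun h => hgt.trans _ _ _ h hxy) (fun h => hgt.trans _ _ _ h hxy)
  obtain ⟨s', t', hs, hst, ht⟩ := h
  rcases hs.cases_head with rfl | ⟨s₁, hs₁, hs⟩ <;> rcases ht.cases_head with rfl | ⟨t₁, ht₁, ht⟩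
  · exact .inl hst
  · obtain ⟨hconv, ht'⟩ := ConvOn.of_reflTransGen (B := B) hR hdown ht (.inr (hR _ _ ht₁))
    have hts : gt t s := by
      obtain ⟨-, h⟩ := ConvOn.of_reflTransGen (B := B) (K := gt t) hR
        (fun x y => hgt.trans t x y) ht (hR _ _ ht₁)
      exact hgt.of_sim_right h hst.symm
    exact .inr ⟨s, t₁, .inr ⟨rfl, hts⟩, .inl ht₁,
      .trans (.of_sim hst (.inr hts) ht') hconv.symm⟩
  · obtain ⟨hconv, hs'⟩ := ConvOn.of_reflTransGen (B := B) hR hdown hs (.inl (hR _ _ hs₁))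
    have hst' : gt s t := by
      obtain ⟨-, h⟩ := ConvOn.of_reflTransGen (B := B) (K := gt s) hR
        (fun x y => hgt.trans s x y) hs (hR _ _ hs₁)
      exact hgt.of_sim_right h hst
    exact .inr ⟨s₁, t, .inl hs₁, .inr ⟨rfl, hst'⟩,
      hconv.trans (.of_sim hst hs' (.inl hst'))⟩
  · obtain ⟨hs, hs'⟩ := ConvOn.of_reflTransGen (B := B) hR hdown hs (.inl (hR _ _ hs₁))
    obtain ⟨ht, ht'⟩ := ConvOn.of_reflTransGen (B := B) hR hdown ht (.inr (hR _ _ ht₁))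
    exact .inr ⟨s₁, t₁, .inl hs₁, .inl ht₁, hs.trans (.trans (.of_sim hst hs' ht') ht.symm)⟩

theorem StepIB.rules_subset {S S' : State L V} (hstep : StepIB B gt S S')
    (hS : ∀ s t, (s, t) ∈ S.2 → gt s t) : ∀ s t, (s, t) ∈ S'.2 → gt s t := by
  rcases hstep with ⟨_, _, _, _, _, rfl⟩ | ⟨_, s, t, _, _, h, rfl⟩ | ⟨_, _, _, _, rfl⟩ |
    ⟨_, _, _, _, _, _, _, rfl⟩ | ⟨_, _, _, _, _, rfl⟩ | ⟨s, t, u, hst, h, rfl⟩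
  · exact hS
  · rintro s' t' (h' | h')
    · exact hS _ _ h'
    · cases h'; exact h
  · exact hS
  · exact hS
  · exact fun s t h => hS s t h.1
  · rintro s' t' (h' | h')
    · exact hS _ _ h'.1
    · cases h'
      exact hgt.trans _ _ _ (hS _ _ hst) (hgt.of_rew hS (h.mono Set.sdiff_subset))

/-- Simulation of all rules and equations of a state is propagated backwards by an inference
step. -/
theorem StepIB.simulated (hR : ∀ s t, Rew R s t → gt s t) {S S' : State L V}
    (hstep : StepIB B gt S S') (hS : ∀ s t, (s, t) ∈ S.2 → gt s t)
    (hrule : ∀ s t, (s, t) ∈ S'.2 → SimulatedStep gt R B s t)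
    (heq : ∀ s t, (s, t) ∈ S'.1 → SimulatedEq gt R B s t) :
    (∀ s t, (s, t) ∈ S.2 → SimulatedStep gt R B s t) ∧
      ∀ s t, (s, t) ∈ S.1 → SimulatedEq gt R B s t := by
  have hdown : ∀ s, DownClosed gt (gt s) := fun s x y => hgt.trans s x y
  have hS' : ∀ s t, Rew S.2 s t → gt s t := fun _ _ => hgt.of_rew hS
  have hrew : ∀ s t, Rew S'.2 s t → SimulatedStep gt R B s t := fun _ _ =>
    Rew.rel (closedContext_simulatedStep hgt) (closedSubst_simulatedStep hgt) hrule
  rcases hstep with ⟨_, _, _, _, _, rfl⟩ | ⟨e, s, t, he, heS, hst, rfl⟩ | ⟨s, t, _, hst, rfl⟩ |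
    ⟨e, s, t, u, he, heS, hsu, rfl⟩ | ⟨s, t, u, hst, hsu, rfl⟩ | ⟨s, t, u, hst, htu, rfl⟩
  · exact ⟨hrule, fun s t h => heq s t (.inl h)⟩
  · refine ⟨fun s t h => hrule s t (.inl h), fun s' t' h => ?_⟩
    by_cases hne : (s', t') = e
    · have hsim : SimulatedEq gt R B s t := (hrule s t (.inr rfl)).simulatedEq hst
      subst hne
      rcases he with he | he <;> cases he
      exacts [hsim, hsim.symm]
    · exact heq _ _ ⟨h, hne⟩
  · refine ⟨hrule, fun s' t' h => ?_⟩
    by_cases hne : (s', t') = (s, t)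
    · cases hne; exact .inl hst
    · exact heq _ _ ⟨h, hne⟩
  · refine ⟨hrule, fun s' t' h => ?_⟩
    by_cases hne : (s', t') = e
    · have hsim : SimulatedEq gt R B s t :=
        .simplify hgt hR (hrew _ _ hsu) (hS' _ _ hsu) (heq u t (.inr rfl))
      subst hne
      rcases he with he | he <;> cases he
      exacts [hsim, hsim.symm]
    · exact heq _ _ (.inl ⟨h, hne⟩)
  · refine ⟨fun s' t' h => ?_, fun s t h => heq s t (.inl h)⟩
    by_cases hne : (s', t') = (s, t)
    · cases hne
      have hsu' : gt s u := hS' _ _ (hsu.mono Set.sdiff_subset)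
      obtain ⟨w, hw, hwu⟩ := hrew _ _ hsu
      exact ⟨w, hw, hwu.trans ((heq u t (.inr rfl)).convOn hR (hdown s) hsu' (hS _ _ hst))⟩
    · exact hrule _ _ ⟨h, hne⟩
  · refine ⟨fun s' t' h => ?_, heq⟩
    by_cases hne : (s', t') = (s, t)
    · cases hne
      obtain ⟨w, hw, hwu⟩ := hrule s u (.inr rfl)
      have htu := hrew _ _ (htu.mono fun e he => .inl he)
      exact ⟨w, hw, hwu.trans (htu.convOn hR (hdown s) (hS _ _ hst)).symm⟩
    · exact hrule _ _ (.inl ⟨h, hne⟩)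

theorem IsRun.rules_subset {E : System L V} {n : ℕ} {S : ℕ → State L V}
    (hrun : IsRun B gt E n S) : ∀ i ≤ n, ∀ s t, (s, t) ∈ (S i).2 → gt s t := by
  intro i
  induction i with
  | zero => simp [hrun.1]
  | succ i ih => exact fun hi => (hrun.2 i hi).rules_subset hgt (ih (Nat.le_of_succ_le hi))

theorem IsRun.simulated {E : System L V} {n : ℕ} {S : ℕ → State L V} (hrun : IsRun B gt E n S)
    (hend : S n = (∅, R)) {i : ℕ} (hi : i ≤ n) :
    (∀ s t, (s, t) ∈ (S i).2 → SimulatedStep gt R B s t) ∧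
      ∀ s t, (s, t) ∈ (S i).1 → SimulatedEq gt R B s t := by
  have hR : ∀ s t, Rew R s t → gt s t := fun _ _ =>
    hgt.of_rew (by simpa [hend] using hrun.rules_subset hgt n le_rfl)
  induction hi using Nat.decreasingInduction with
  | of_succ i hi ih =>
    exact (hrun.2 i hi).simulated hgt hR (hrun.rules_subset hgt i hi.le) ih.1 ih.2
  | self => simpa [hend] using fun s t h => ⟨t, Rew.of_mem h, .refl⟩

/-- For a fair run, simulation of equations resolves the prime critical pairs. -/
theorem IsFair.resolves {E : System L V} {n : ℕ} {S : ℕ → State L V} (hrun : IsRun B gt E n S)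
    (hend : S n = (∅, R)) (hfair : IsFair B n S) : Resolves R B (SimulatedEq gt R B) := by
  have hR : ∀ s t, Rew R s t → gt s t := fun _ _ =>
    hgt.of_rew (by simpa [hend] using hrun.rules_subset hgt n le_rfl)
  refine ⟨closedContext_simulatedEq hgt, closedSubst_simulatedEq hgt, fun _ _ => .symm,
    fun _ _ => Valley.simulatedEq hgt hR, fun e he => ?_⟩
  have hfair := hfair.2
  rw [hend] at hfair
  rcases hfair e he with h | ⟨i, hi, h | h⟩
  · exact Valley.simulatedEq hgt hR h
  · exact h.rel (closedContext_simulatedEq hgt) (closedSubst_simulatedEq hgt)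
      (hrun.simulated hgt hend hi).2
  · exact (h.rel (closedContext_simulatedEq hgt) (closedSubst_simulatedEq hgt)
      (hrun.simulated hgt hend hi).2).symm

/-- If all prime critical pairs are simulated equations, then the local peaks and cliffs satisfy the
abstract criterion.  In a cliff `t ← s ↔ u`, the term `u` is not smaller than the reduct it is
compared with, so that the simulating conversion starts with a rewrite step from `u`. -/
theorem churchRosserModulo_of_resolves [Infinite V] (hR : ∀ s t, (s, t) ∈ R → gt s t)
    (hlin : LeftLinear R) (hRes : Resolves R B (SimulatedEq gt R B)) :
    ChurchRosserModulo R B := by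
  have hrew : ∀ s t, Rew R s t → gt s t := fun _ _ => hgt.of_rew hR
  have hdown : ∀ s, DownClosed gt (gt s) := fun s x y => hgt.trans s x y
  have htrs := hgt.isTRS hR
  have hvar := hgt.noVariants hR
  refine churchRosserModulo_of_local hgt hrew ?_ ?_
  · intro s t u ht hu
    obtain ⟨v, hv, htv, hvu⟩ := hRes.local_peak htrs hlin hvar (.inl rfl) ht hu
    exact (htv.convOn hrew (hdown s) (hrew _ _ ht) (hrew _ _ hv)).trans
      (hvu.convOn hrew (hdown s) (hrew _ _ hv) (hrew _ _ hu))
  · intro s t u ht hu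
    obtain ⟨v, hv, htv, hvu⟩ := hRes.local_peak htrs hlin hvar (.inr rfl) ht (rew_pm.2 hu)
    have hsu : Sim B s u := .single hu
    have hsv := hrew _ _ hv
    have huv : gt u v := hgt.of_sim_left hsu.symm hsv
    have htv := htv.convOn hrew (hdown s) (hrew _ _ ht) hsv
    rcases hvu with hvu | ⟨v', u', hv', hu' | hu', hconv⟩
    · exact absurd hvu.symm (hgt.not_sim huv)
    · refine ⟨u', hu', htv.trans (.trans ?_ (hconv.mono ?_))⟩
      · rcases hv' with hv' | ⟨rfl, -⟩
        · exact .of_rew hv' hsv (hdown s _ _ hsv (hrew _ _ hv'))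
        · exact .refl
      · rintro x (hx | hx)
        exacts [hgt.trans _ _ _ hsv hx, hgt.of_sim_left hsu hx]
    · exact absurd hu'.2 (hgt.asymm huv)

/-- Right-hand sides on which compose is not applicable are normal forms modulo `B`: by the
Church-Rosser property, a step modulo `B` from an `R`-normal form would lead to a smaller term in
the same `B`-equivalence class. -/
theorem rightReducedModulo (hR : ∀ s t, (s, t) ∈ R → gt s t) (hCR : ChurchRosserModulo R B)
    (hcompose : ¬ ∃ S', Compose (∅, R) S') : RightReducedModulo R B := by
  have hrew : ∀ s t, Rew R s t → gt s t := fun _ _ => hgt.of_rew hR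
  rintro ⟨l, r⟩ he
  have hnf : IsNF (Rew R) r := by
    rintro w ⟨l', r', p, σ, he', hσ, hp, rfl⟩
    by_cases hne : (l', r') = (l, r)
    · cases hne
      exact hgt.not_subterm_subst (hR _ _ he) hσ hp
    · exact hcompose ⟨_, l, r, _, he, ⟨l', r', p, σ, ⟨he', hne⟩, hσ, hp, rfl⟩, rfl⟩
  rintro w ⟨b, ⟨a, hra, hab⟩, -⟩
  have hconv : Conv R B r b := .tail (.single (.inr (.inr hra))) (.inr (.inl hab))
  obtain ⟨r', b', hr, hrb, hb⟩ := hCR _ _ hconv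
  obtain rfl : r = r' := hr.cases_head.resolve_right fun ⟨_, h, _⟩ => hnf _ h
  have hgtb : gt r b := hgt.of_sim_left hra (hrew _ _ hab)
  obtain ⟨-, hgtb'⟩ := ConvOn.of_reflTransGen (B := B) (K := gt r) hrew
    (fun x y => hgt.trans r x y) hb hgtb
  exact hgt.not_sim hgtb' hrb

end

theorem leftReduced_of_not_collapse (hcollapse : ¬ ∃ S', Collapse (∅, R) S') : LeftReduced R :=
  fun _ he _ hw => hcollapse ⟨_, _, _, _, he, hw, rfl⟩

end Simulation

end CompletionModulo

theorem mainTheorem10 {L : FirstOrder.Language.{u, v}} {V : Type w} [Infinite V]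
    (B : System L V) (hB : ∀ e ∈ B, vars e.1 = vars e.2)
    (gt : L.Term V → L.Term V → Prop) (hgt : IsCompatibleReductionOrder B gt)
    (E R : System L V) (n : ℕ) (S : ℕ → State L V)
    (hrun : IsRun B gt E n S) (hend : S n = (∅, R)) (hfair : IsFair B n S)
    (hcompose : ¬ ∃ S', Compose (∅, R) S') (hcollapse : ¬ ∃ S', Collapse (∅, R) S') :
    CanonicalModulo R B := by
  have hR : ∀ s t, (s, t) ∈ R → gt s t := by simpa [hend] using hrun.rules_subset hgt n le_rfl
  have hlin : LeftLinear R := by simpa [hend] using hfair.1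
  have hCR := churchRosserModulo_of_resolves hgt hR hlin (hfair.resolves hgt hrun hend)
  exact ⟨hgt.isTRS hR, ⟨hgt.terminatingModulo hR, hCR⟩, leftReduced_of_not_collapse hcollapse,
    rightReducedModulo hgt hR hCR hcompose⟩
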